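/- Let $d\in\mathbb N$ and write $\widehat f(\xi)=(2\pi)^{-d/2}\int_{\mathbb R^d}f(x)e^{-i\langle x,\xi\rangle}\,dx$ for the Fourier transform, extended by continuity to $L^2(\mathbb R^d)$. For a multi-index $\alpha\in\mathbb N^d$ with $|\alpha|=\alpha_1+\cdots+\alpha_d$ let $$h_\alpha(x)=(-1)^{|\alpha|}\pi^{-d/4}(2^{|\alpha|}\alpha!)^{-1/2}e^{|x|^2/2}\,\frac{\partial^\alpha}{\partial x^\alpha}\bigl[e^{-|x|^2}\bigr]$$ be the Hermite functions, and let $H(f,\alpha)=(f,h_\alpha)_{L^2}=\int_{\mathbb R^d}f(x)h_\alpha(x)\,dx$. The Pilipović space $\mathcal H_{0,1/2}(\mathbb R^d)$ consists of all Hermite series $\sum_{\alpha}c_\alpha h_\alpha$ (convergent in $L^2$) whose coefficients $c_\alpha\in\mathbb C$ satisfy: for every $r>0$ there is $C>0$ with $|c_\alpha|\le Ce^{-r|\alpha|}$ for all $\alpha$. **Theorem.** For $f\in L^2(\mathbb R^d)$ the following statements are equivalent. (i) For every $j\in\{1,\dots,d\}$ and every $\lambda>0$ there is $C>0$ such that $|f(x)|\le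 Ce^{-(\frac12-\lambda)|x_j|^2}$ for almost every $x\in\mathbb R^d$ and $|\widehat f(\xi)|\le Ce^{-(\frac12-\lambda)|\xi_j|^2}$ for almost every $\xi\in\mathbb R^d$. (ii) For every $\lambda>0$ there is $C>0$ such that $|f(x)|\le Ce^{-(\frac12-\lambda)|x|^2}$ for almost every $x\in\mathbb R^d$ and $|\widehat f(\xi)|\le Ce^{-(\frac12-\lambda)|\xi|^2}$ for almost every $\xi\in\mathbb R^d$. (iii) For every $r>0$ there is $C>0$ such that $|H(f,\alpha)|\le Ce^{-r|\alpha|}$ for all $\alpha\in\mathbb N^d$. (iv) $f\in\mathcal H_{0,1/2}(\mathbb R^d)$. -/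

import Mathlib

open MeasureTheory Filter Topology
open scoped FourierTransform

noncomputable section

/-- The space `L²(ℝ^d)` of (classes of) complex-valued square-integrable functions. -/
abbrev L2 (d : ℕ) : Type :=
  Lp (α := EuclideanSpace ℝ (Fin d)) ℂ 2 (volume : Measure (EuclideanSpace ℝ (Fin d)))

/-- The unitary Fourier transform on `L²(ℝ^d)` with angular frequency, that is the continuous
extension to `L²` of `f ↦ (ξ ↦ (2π)^(-d/2) ∫ f(x) e^{-i⟨x,ξ⟩} dx)`. Mathlib's Fourier transform
on `L²` extends `ξ ↦ ∫ f(x) e^{-2πi⟨x,ξ⟩} dx`; hence the rescaling of the variable by `1/(2π)`.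
(The dilation preserves null sets, so the result is well defined up to null sets.) -/
def fourierHat {d : ℕ} (f : L2 d) : EuclideanSpace ℝ (Fin d) → ℂ :=
  fun ξ => (((2 * Real.pi) ^ (-(d : ℝ) / 2) : ℝ) : ℂ) * (𝓕 f : L2 d) ((2 * Real.pi)⁻¹ • ξ)

/-- The length `|α| = α₁ + ⋯ + α_d` of a multi-index. -/
def multiLength {d : ℕ} (α : Fin d → ℕ) : ℕ := ∑ j, α j

/-- The factorial `α! = α₁! ⋯ α_d!` of a multi-index. -/
def multiFactorial {d : ℕ} (α : Fin d → ℕ) : ℕ := ∏ j, Nat.factorial (α j)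

/-- The partial derivative `∂g/∂x_j`. -/
def partialD {d : ℕ} (j : Fin d) (g : EuclideanSpace ℝ (Fin d) → ℝ) :
    EuclideanSpace ℝ (Fin d) → ℝ :=
  fun x => lineDeriv ℝ g x (EuclideanSpace.single j 1)

/-- The iterated partial derivative `∂^α g = ∂₁^{α₁} ⋯ ∂_d^{α_d} g`. -/
def multiPartialD {d : ℕ} (α : Fin d → ℕ) (g : EuclideanSpace ℝ (Fin d) → ℝ) :
    EuclideanSpace ℝ (Fin d) → ℝ :=
  (List.finRange d).foldr (fun j u => (partialD j)^[α j] u) g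

/-- The Hermite functions
`h_α(x) = (-1)^|α| π^(-d/4) (2^|α| α!)^(-1/2) e^(|x|²/2) ∂^α [e^(-|x|²)]`. -/
def hermiteFun {d : ℕ} (α : Fin d → ℕ) (x : EuclideanSpace ℝ (Fin d)) : ℝ :=
  (-1) ^ multiLength α * Real.pi ^ (-(d : ℝ) / 4)
    * ((2 : ℝ) ^ multiLength α * (multiFactorial α : ℝ)) ^ (-(1 / 2) : ℝ)
    * Real.exp (‖x‖ ^ 2 / 2)
    * multiPartialD α (fun y => Real.exp (-‖y‖ ^ 2)) x

/-- The Hermite coefficient `H(f, α) = (f, h_α)_{L²} = ∫ f(x) h_α(x) dx`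
(the Hermite functions are real-valued). -/
def hermiteCoeff {d : ℕ} (f : L2 d) (α : Fin d → ℕ) : ℂ :=
  ∫ x, f x * (hermiteFun α x : ℂ)

/-- The bound `|c_α| ≲ e^(-r|α|)` for all `r > 0`; the implied constant may depend on `r`. -/
def SuperexpDecay {d : ℕ} (c : (Fin d → ℕ) → ℂ) : Prop :=
  ∀ r : ℝ, 0 < r → ∃ C : ℝ, ∀ α : Fin d → ℕ, ‖c α‖ ≤ C * Real.exp (-r * (multiLength α : ℝ))

/-- The Pilipović space `𝓗_{0,1/2}(ℝ^d)`: all Hermite series `f = ∑_α c_α h_α` (converging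
unconditionally in `L²`) whose coefficients satisfy `|c_α| ≲ e^(-r|α|)` for all `r > 0`. -/
def pilipovicSpace (d : ℕ) : Set (L2 d) :=
  {f | ∃ c : (Fin d → ℕ) → ℂ, SuperexpDecay c ∧
    Tendsto (fun s : Finset (Fin d → ℕ) =>
      eLpNorm (fun x => f x - ∑ α ∈ s, c α * (hermiteFun α x : ℂ)) 2 volume) atTop (𝓝 0)}

/-- Nearly optimal Gaussian decay of a (class of a) function `g` on `ℝ^d`, measured along
`ρ : ℝ^d → ℝ`: for all `μ > 0` there is `C` with `|g(x)| ≤ C e^(-(1/2-μ) ρ(x)²)` for almost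
every `x`. -/
def NearlyOptimalDecay {d : ℕ} (g : EuclideanSpace ℝ (Fin d) → ℂ)
    (ρ : EuclideanSpace ℝ (Fin d) → ℝ) : Prop :=
  ∀ μ : ℝ, 0 < μ → ∃ C : ℝ, ∀ᵐ x ∂(volume : Measure (EuclideanSpace ℝ (Fin d))),
    ‖g x‖ ≤ C * Real.exp (-(1 / 2 - μ) * ρ x ^ 2)

end

/-! Everything passes through the Hermite coefficients. The `h_α` form a Hilbert basis of `L²`, so a
Hermite expansion determines its coefficients and (iii) ⇔ (iv) (`mem_pilipovicSpace_iff`). The step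
(ii) ⇒ (i) is `|x_j| ≤ ‖x‖`.

(iii) ⇒ (ii): for every `ε > 0`, `|h_α(x)| ≤ e^(A(|α|+d)) e^(-(1/2-ε)|x|²)` with `A` depending only
on `ε` (`abs_hermiteFun_le`). Coefficients smaller than every exponential absorb `e^(A|α|)`, and the
series inherits the Gaussian bound. The Fourier transform multiplies the coefficients by `(-i)^|α|`
(`hermiteCoeff_fourierHatLp`), so the same holds for the transform of `f`.

(i) ⇒ (iii): fix `j` and all entries of `α` except `α_j`. The numbers `H(f, α)/√(α_j!)` are the
Taylor coefficients of an entire function `F`, the pairing of `f` with the Bargmann kernel in `x_j`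
and with Hermite functions in the other variables. Decay of `f` gives `|F(z)| ≤ C exp((Im z)²/2 + λ
(Re z)²)`. The Fourier transform rotates `z` by a quarter turn, so decay of the transform gives the
same bound with `Re` and `Im` exchanged. Thus `F` has small type near both axes, and
Phragmén–Lindelöf in each quadrant gives small type everywhere (`AxialGrowth.norm_le`). Cauchy's
estimate on a circle of radius comparable to `√(n+1)`, with `n = α_j`, yields `|H(f, α)| ≤ C e^(-r
α_j)`, uniformly in the other entries. Finally, the largest entry of `α` is at least `|α|/d`. -/

/-! ### Hermite polynomials and Hermite functions on the line -/

open Polynomial in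
/-- The physicists' Hermite polynomials. -/
noncomputable def physHermite : ℕ → ℝ[X]
  | 0 => 1
  | n + 1 => C 2 * X * physHermite n - derivative (physHermite n)

lemma iterate_deriv_gaussian (n : ℕ) :
    deriv^[n] (fun t : ℝ => Real.exp (-t ^ 2)) =
      fun t => (-1) ^ n * (physHermite n).eval t * Real.exp (-t ^ 2) := by
  induction n with
  | zero => simp [physHermite]
  | succ n ih =>
    rw [Function.iterate_succ_apply', ih]
    ext t
    have h1 : HasDerivAt (fun t : ℝ => Real.exp (-t ^ 2)) (Real.exp (-t ^ 2) * (-(2 * t))) t := by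
      simpa using ((hasDerivAt_pow 2 t).neg).exp
    have h2 := ((((physHermite n).hasDerivAt t).const_mul ((-1 : ℝ) ^ n)).mul h1).deriv
    refine h2.trans ?_
    simp [physHermite, pow_succ]
    ring

lemma iteratedDeriv_generating (t : ℝ) (n : ℕ) :
    iteratedDeriv n (fun s : ℂ => Complex.exp (2 * t * s - s ^ 2)) =
      fun s => Polynomial.aeval ((t : ℂ) - s) (physHermite n) *
        Complex.exp (2 * t * s - s ^ 2) := by
  induction n with
  | zero => simp [physHermite]
  | succ n ih =>
    rw [iteratedDeriv_succ, ih]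
    ext s
    have h1 : HasDerivAt (fun s : ℂ => Complex.exp (2 * t * s - s ^ 2))
        (Complex.exp (2 * t * s - s ^ 2) * (2 * t - 2 * s)) s := by
      simpa using (((hasDerivAt_id s).const_mul (2 * (t : ℂ))).sub (hasDerivAt_pow 2 s)).cexp
    have h0 : HasDerivAt (fun s : ℂ => (t : ℂ) - s) (-1) s := by
      simpa using (hasDerivAt_id s).const_sub (t : ℂ)
    have h2 := ((((physHermite n).hasDerivAt_aeval ((t : ℂ) - s)).comp s h0).mul h1).deriv
    refine h2.trans ?_
    simp [physHermite]
    ring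

lemma hasSum_physHermite (t : ℝ) (s : ℂ) :
    HasSum (fun n : ℕ => (n.factorial : ℂ)⁻¹ * (s ^ n * (((physHermite n).eval t : ℝ) : ℂ)))
      (Complex.exp (2 * t * s - s ^ 2)) := by
  have h := Complex.hasSum_taylorSeries_of_entire
    (f := fun s : ℂ => Complex.exp (2 * t * s - s ^ 2)) (by fun_prop) 0 s
  have e (n : ℕ) : Polynomial.aeval (t : ℂ) (physHermite n) =
      (((physHermite n).eval t : ℝ) : ℂ) := by
    simpa using Polynomial.aeval_algebraMap_apply ℂ t (physHermite n)
  simpa [iteratedDeriv_generating, e] using h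

/-- The constant normalizing the `n`-th Hermite function in `L²(ℝ)`. -/
noncomputable def hermiteNormalizer (n : ℕ) : ℝ :=
  (√(√Real.pi * (2 ^ n * n.factorial)))⁻¹

lemma hermiteNormalizer_sq (n : ℕ) :
    hermiteNormalizer n ^ 2 * (√Real.pi * (2 ^ n * n.factorial)) = 1 := by
  unfold hermiteNormalizer
  rw [inv_pow, Real.sq_sqrt (by positivity)]
  exact inv_mul_cancel₀ (by positivity)

/-- The normalized Hermite functions on the real line. -/
noncomputable def hermiteFn (n : ℕ) (t : ℝ) : ℝ :=
  hermiteNormalizer n * ((physHermite n).eval t * Real.exp (-t ^ 2 / 2))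

@[fun_prop]
lemma continuous_hermiteFn (n : ℕ) : Continuous (hermiteFn n) := by
  unfold hermiteFn
  have := (physHermite n).continuous
  fun_prop

lemma integrable_eval_mul_exp (p : Polynomial ℝ) {b : ℝ} (hb : 0 < b) :
    Integrable (fun t : ℝ => p.eval t * Real.exp (-b * t ^ 2)) := by
  induction p using Polynomial.induction_on' with
  | add p q hp hq =>
    refine (hp.add hq).congr (ae_of_all _ fun t => ?_)
    simp [add_mul]
  | monomial n a =>
    have h := (integrable_rpow_mul_exp_neg_mul_sq hb
      (s := (n : ℝ)) (by linarith [n.cast_nonneg (α := ℝ)])).const_mul a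
    simpa [Polynomial.eval_monomial, mul_assoc] using h

/-- Integration by parts: `(H_n p e^(-t²))' = (H_n p' - H_(n+1) p) e^(-t²)`, and the integral of the
left side vanishes. With `H_(m+1)' = 2(m+1) H_m` this lowers both indices at once in the
orthogonality relation. -/
lemma integral_physHermite_succ_mul (n : ℕ) (p : Polynomial ℝ) :
    ∫ t : ℝ, (physHermite (n + 1) * p).eval t * Real.exp (-1 * t ^ 2) =
      ∫ t : ℝ, (physHermite n * p.derivative).eval t * Real.exp (-1 * t ^ 2) := by
  have hd (t : ℝ) : HasDerivAt
      (fun t => (physHermite n * p).eval t * Real.exp (-1 * t ^ 2))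
      ((physHermite n * p.derivative).eval t * Real.exp (-1 * t ^ 2)
        - (physHermite (n + 1) * p).eval t * Real.exp (-1 * t ^ 2)) t := by
    have h1 : HasDerivAt (fun t : ℝ => Real.exp (-1 * t ^ 2))
        (Real.exp (-1 * t ^ 2) * (-(2 * t))) t := by
      simpa using (((hasDerivAt_pow 2 t).const_mul (-1 : ℝ))).exp
    refine (((physHermite n * p).hasDerivAt t).mul h1).congr_deriv ?_
    simp [physHermite]
    ring
  have h := integral_eq_zero_of_hasDerivAt_of_integrable hd
    ((integrable_eval_mul_exp _ one_pos).sub (integrable_eval_mul_exp _ one_pos))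
    (integrable_eval_mul_exp _ one_pos)
  rw [integral_sub (integrable_eval_mul_exp _ one_pos) (integrable_eval_mul_exp _ one_pos)] at h
  linarith

lemma derivative_physHermite_succ (n : ℕ) :
    Polynomial.derivative (physHermite (n + 1)) =
      Polynomial.C (2 * (n + 1 : ℝ)) * physHermite n := by
  induction n with
  | zero => simp [physHermite]
  | succ n ih =>
    have e : physHermite (n + 1 + 1) = Polynomial.C 2 * Polynomial.X * physHermite (n + 1)
      - Polynomial.derivative (physHermite (n + 1)) := rfl
    have e' : Polynomial.derivative (physHermite n) =
      Polynomial.C 2 * Polynomial.X * physHermite n - physHermite (n + 1) := by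
      rw [physHermite]; ring
    rw [e, Polynomial.derivative_sub, Polynomial.derivative_mul, ih]
    simp only [Polynomial.derivative_mul, Polynomial.derivative_C, Polynomial.derivative_X, e']
    simp only [map_mul, map_add, Polynomial.C_1, Nat.cast_add, Nat.cast_one]
    ring

lemma integral_physHermite_mul (n m : ℕ) :
    ∫ t : ℝ, (physHermite n * physHermite m).eval t * Real.exp (-1 * t ^ 2) =
      if n = m then √Real.pi * (2 ^ n * n.factorial) else 0 := by
  induction n generalizing m with
  | zero =>
    cases m with
    | zero => simpa [physHermite] using integral_gaussian 1
    | succ m => rw [mul_comm, integral_physHermite_succ_mul]; simp [physHermite]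
  | succ n ih =>
    rw [integral_physHermite_succ_mul]
    cases m with
    | zero => simp [physHermite]
    | succ m =>
      rw [derivative_physHermite_succ]
      have : ∀ t : ℝ, (physHermite n * (Polynomial.C (2 * (m + 1 : ℝ)) * physHermite m)).eval t
          * Real.exp (-1 * t ^ 2) = (2 * (m + 1 : ℝ)) *
          ((physHermite n * physHermite m).eval t * Real.exp (-1 * t ^ 2)) := by
        intro t; simp; ring
      simp_rw [this]
      rw [integral_const_mul, ih]
      split_ifs with h1 h2 h2
      · subst h1; push_cast [Nat.factorial_succ]; ring
      · omega
      · omega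
      · simp

lemma hermiteFn_mul (n m : ℕ) (t : ℝ) : hermiteFn n t * hermiteFn m t =
    hermiteNormalizer n * hermiteNormalizer m *
      ((physHermite n * physHermite m).eval t * Real.exp (-1 * t ^ 2)) := by
  have : Real.exp (-1 * t ^ 2) = Real.exp (-t ^ 2 / 2) * Real.exp (-t ^ 2 / 2) := by
    rw [← Real.exp_add]; ring_nf
  rw [this, Polynomial.eval_mul, hermiteFn, hermiteFn]; ring

lemma integral_hermiteFn_mul (n m : ℕ) :
    ∫ t : ℝ, hermiteFn n t * hermiteFn m t = if n = m then 1 else 0 := by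
  simp_rw [hermiteFn_mul]
  rw [integral_const_mul, integral_physHermite_mul]
  split_ifs with h
  · subst h; rw [← sq, hermiteNormalizer_sq]
  · simp

lemma integrable_hermiteFn_mul (n m : ℕ) :
    Integrable (fun t : ℝ => hermiteFn n t * hermiteFn m t) := by
  simp_rw [hermiteFn_mul]
  exact (integrable_eval_mul_exp _ one_pos).const_mul _

lemma integrable_hermiteFn (n : ℕ) : Integrable (hermiteFn n) := by
  refine ((integrable_eval_mul_exp (physHermite n) (b := 1 / 2) (by norm_num)).const_mul
    (hermiteNormalizer n)).congr (ae_of_all _ fun t => ?_)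
  simp only [hermiteFn]; congr 3; ring

/-! ### The Bargmann kernel, Cauchy estimates and pointwise bounds -/

/-- The generating kernel of the Hermite functions (the kernel of the Bargmann transform). -/
noncomputable def bargmannKernel (z : ℂ) (t : ℝ) : ℂ :=
  (√(√Real.pi) : ℝ)⁻¹ * Complex.exp (-z ^ 2 / 2 + √2 * z * t - t ^ 2 / 2)

@[fun_prop]
lemma continuous_bargmannKernel (z : ℂ) : Continuous (bargmannKernel z) := by
  unfold bargmannKernel; fun_prop

/-- The generating function of the Hermite polynomials at `s = z/√2`, times `π^(-1/4) e^(-t²/2)`.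
Normalizing the Hermite functions absorbs `2^(-n/2)` and one of the two factors `1/√n!` of `1/n!`.
-/
lemma hasSum_hermiteFn (z : ℂ) (t : ℝ) :
    HasSum (fun n : ℕ => z ^ n / (√n.factorial : ℝ) * (hermiteFn n t : ℂ))
      (bargmannKernel z t) := by
  have h := (hasSum_physHermite t (z / (√2 : ℝ))).mul_left
    (((√(√Real.pi))⁻¹ : ℝ) * Complex.exp (-t ^ 2 / 2))
  have h2 : ((√2 : ℝ) : ℂ) ^ 2 = 2 := by
    rw [← Complex.ofReal_pow, Real.sq_sqrt (by norm_num)]; norm_num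
  have h20 : ((√2 : ℝ) : ℂ) ≠ 0 := by simp
  have e : bargmannKernel z t = (((√(√Real.pi))⁻¹ : ℝ) * Complex.exp (-t ^ 2 / 2)) *
      Complex.exp (2 * t * (z / (√2 : ℝ)) - (z / (√2 : ℝ)) ^ 2) := by
    rw [mul_assoc, ← Complex.exp_add, bargmannKernel]
    push_cast
    congr 2
    rw [div_pow, h2]
    field_simp
    linear_combination 2 * z * t * h2
  rw [e]
  convert! h using 2 with n
  have hf : ((√(n.factorial : ℝ) : ℝ) : ℂ) ^ 2 = n.factorial := by
    rw [← Complex.ofReal_pow, Real.sq_sqrt (by positivity)]; norm_num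
  have hf0 : ((√(n.factorial : ℝ) : ℝ) : ℂ) ≠ 0 := by
    simp [Nat.factorial_ne_zero]
  have hn : hermiteNormalizer n = (√(√Real.pi))⁻¹ * ((√2) ^ n)⁻¹ * (√(n.factorial : ℝ))⁻¹ := by
    rw [hermiteNormalizer, Real.sqrt_mul (by positivity), Real.sqrt_mul (by positivity),
      Real.sqrt_eq_rpow (2 ^ n), ← Real.rpow_natCast_mul (by norm_num), mul_comm (n : ℝ),
      Real.rpow_mul_natCast (by norm_num), ← Real.sqrt_eq_rpow, mul_inv, mul_inv]
    ring
  rw [hermiteFn, hn, ← hf]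
  push_cast
  rw [div_pow]
  field_simp

lemma norm_bargmannKernel (z : ℂ) (t : ℝ) :
    ‖bargmannKernel z t‖ =
      (√(√Real.pi))⁻¹ * Real.exp (-(z.re ^ 2 - z.im ^ 2) / 2 + √2 * z.re * t - t ^ 2 / 2) := by
  rw [bargmannKernel, norm_mul, Complex.norm_exp]
  congr 1
  · simp [abs_of_nonneg, Real.sqrt_nonneg]
  · congr 1
    have : -z ^ 2 / 2 + √2 * z * t - t ^ 2 / 2 =
      (((-(z.re ^ 2 - z.im ^ 2) / 2 + √2 * z.re * t - t ^ 2 / 2 : ℝ) : ℂ) +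
        ((-z.re * z.im + √2 * z.im * t : ℝ) : ℂ) * Complex.I) := by
      conv_lhs => rw [← Complex.re_add_im z]
      push_cast
      linear_combination (-(z.im : ℂ) ^ 2 / 2) * Complex.I_sq
    rw [this, Complex.add_re, Complex.re_ofReal_mul, Complex.I_re, Complex.ofReal_re]
    ring

lemma inv_sqrt_sqrt_pi_le_one : (√(√Real.pi))⁻¹ ≤ 1 := by
  apply inv_le_one_of_one_le₀
  rw [Real.one_le_sqrt, Real.one_le_sqrt]
  linarith [Real.pi_gt_three]

lemma hasFPowerSeriesOnBall_of_hasSum_pow {a : ℕ → ℂ} {F : ℂ → ℂ}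
    (h : ∀ z, HasSum (fun n => z ^ n * a n) (F z)) :
    HasFPowerSeriesOnBall F (FormalMultilinearSeries.ofScalars ℂ a) 0 ⊤ where
  r_le := by
    refine ENNReal.le_of_forall_nnreal_lt fun r _ => ?_
    apply FormalMultilinearSeries.le_radius_of_summable_norm
    have := (h r).summable.norm
    refine this.congr fun n => ?_
    simp [mul_comm]
  r_pos := ENNReal.zero_lt_top
  hasSum := fun {y} _ => by
    simpa [FormalMultilinearSeries.ofScalars_apply_eq, mul_comm] using h y

lemma differentiable_of_hasSum_pow {a : ℕ → ℂ} {F : ℂ → ℂ}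
    (h : ∀ z, HasSum (fun n => z ^ n * a n) (F z)) : Differentiable ℂ F := fun z =>
  ((hasFPowerSeriesOnBall_of_hasSum_pow h).differentiableOn z (by simp)).differentiableAt
    (by simp)

lemma norm_le_of_hasSum_pow {a : ℕ → ℂ} {F : ℂ → ℂ}
    (h : ∀ z, HasSum (fun n => z ^ n * a n) (F z)) {R C : ℝ} (hR : 0 < R)
    (hC : ∀ z : ℂ, ‖z‖ = R → ‖F z‖ ≤ C) (n : ℕ) : ‖a n‖ ≤ C / R ^ n := by
  have h1 := (hasFPowerSeriesOnBall_of_hasSum_pow h).factorial_smul 1 n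
  rw [← iteratedDeriv_eq_iteratedFDeriv] at h1
  have h2 := Complex.norm_iteratedDeriv_le_of_forall_mem_sphere_norm_le (c := 0) n hR
    (differentiable_of_hasSum_pow h).diffContOnCl (fun z hz => hC z (by simpa using hz))
  rw [← h1] at h2
  have hn : (0 : ℝ) < n.factorial := by positivity
  simp only [FormalMultilinearSeries.ofScalars_apply_eq, one_pow, smul_eq_mul, mul_one,
    nsmul_eq_mul, norm_mul, Complex.norm_natCast, mul_div_assoc] at h2
  exact le_of_mul_le_mul_left h2 hn

lemma sqrt_factorial_le (n : ℕ) : √(n.factorial : ℝ) ≤ √(n + 1 : ℝ) ^ n := by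
  rw [Real.sqrt_le_left (by positivity), ← pow_mul, mul_comm, pow_mul,
    Real.sq_sqrt (by positivity)]
  calc (n.factorial : ℝ) ≤ (n : ℝ) ^ n := by exact_mod_cast Nat.factorial_le_pow n
    _ ≤ (n + 1 : ℝ) ^ n := by gcongr; linarith

/-- Cauchy's estimate for `z ↦ bargmannKernel z t` on the circle of radius `√(n+1)`, whose `n`-th
power dominates `√n!`; `n + 1` in place of `n` keeps the radius positive at `n = 0`. Only
exponential growth in `n` matters later. -/
lemma norm_hermiteFn_le (n : ℕ) (t : ℝ) {ε : ℝ} (hε : 0 < ε) :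
    |hermiteFn n t| ≤ Real.exp ((n + 1) * (1 / 2 + 1 / (2 * ε))) *
      Real.exp (-(1 / 2 - ε) * t ^ 2) := by
  have hR : 0 < √(n + 1 : ℝ) := by positivity
  have hR2 : √(n + 1 : ℝ) ^ 2 = n + 1 := Real.sq_sqrt (by positivity)
  have h := norm_le_of_hasSum_pow (a := fun n => (hermiteFn n t : ℂ) / (√n.factorial : ℝ))
    (F := fun z => bargmannKernel z t) (R := √(n + 1))
    (C := Real.exp ((n + 1) * (1 / 2 + 1 / (2 * ε))) * Real.exp (-(1 / 2 - ε) * t ^ 2))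
    (fun z => by
      convert! hasSum_hermiteFn z t using 2
      ring) hR ?_ n
  · have h1 : √(n.factorial : ℝ) ≤ √(n + 1) ^ n := sqrt_factorial_le n
    rw [norm_div, Complex.norm_real, Complex.norm_real, Real.norm_eq_abs, Real.norm_of_nonneg
      (Real.sqrt_nonneg _), div_le_iff₀ (by positivity)] at h
    refine h.trans ?_
    rw [div_mul_eq_mul_div, div_le_iff₀ (by positivity)]
    gcongr
  · intro z hz
    rw [norm_bargmannKernel, ← Real.exp_add]
    refine (mul_le_of_le_one_left (Real.exp_nonneg _) inv_sqrt_sqrt_pi_le_one).trans ?_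
    apply Real.exp_le_exp.2
    have hz2 : z.re ^ 2 + z.im ^ 2 = n + 1 := by
      rw [← hR2, ← hz, Complex.sq_norm, Complex.normSq_apply]; ring
    have h2 : √2 ^ 2 = (2 : ℝ) := Real.sq_sqrt (by norm_num)
    have key : √2 * z.re * t ≤ ε * t ^ 2 + z.re ^ 2 / (2 * ε) := by
      have := sq_nonneg (√2 * ε * t - z.re)
      rw [← sub_nonneg]
      have e : ε * t ^ 2 + z.re ^ 2 / (2 * ε) - √2 * z.re * t =
        (√2 * ε * t - z.re) ^ 2 / (2 * ε) := by
        field_simp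
        ring_nf
        rw [h2]
      rw [e]; positivity
    have h3 : z.re ^ 2 / (2 * ε) ≤ (n + 1) / (2 * ε) := by
      gcongr; nlinarith [sq_nonneg z.im]
    have e : ((n : ℝ) + 1) * (1 / 2 + 1 / (2 * ε)) = (n + 1) / 2 + (n + 1) / (2 * ε) := by ring
    rw [e]
    nlinarith [sq_nonneg z.re]


/-! ### Hermite functions on the line as eigenfunctions of the Fourier transform -/

lemma hasDerivAt_hermiteFn_aux (n : ℕ) (t : ℝ) :
    HasDerivAt (fun t : ℝ => (physHermite n).eval t * Real.exp (-t ^ 2 / 2))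
      (t * ((physHermite n).eval t * Real.exp (-t ^ 2 / 2))
        - (physHermite (n + 1)).eval t * Real.exp (-t ^ 2 / 2)) t := by
  have h1 : HasDerivAt (fun t : ℝ => Real.exp (-t ^ 2 / 2)) (Real.exp (-t ^ 2 / 2) * (-t)) t := by
    have := (((hasDerivAt_pow 2 t).neg).div_const 2).exp
    convert! this using 2
    simp; ring
  refine (((physHermite n).hasDerivAt t).mul h1).congr_deriv ?_
  simp [physHermite]
  ring

lemma integrable_eval_mul_exp_half (p : Polynomial ℝ) :
    Integrable (fun t : ℝ => ((p.eval t * Real.exp (-t ^ 2 / 2) : ℝ) : ℂ)) := by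
  refine (integrable_eval_mul_exp p (b := 1 / 2) (by norm_num)).ofReal.congr
    (ae_of_all _ fun t => ?_)
  dsimp only
  congr 3
  ring

lemma fourier_gaussian_half (w : ℝ) :
    𝓕 (fun t : ℝ => ((Real.exp (-t ^ 2 / 2) : ℝ) : ℂ)) w =
      √(2 * Real.pi) * Real.exp (-(2 * Real.pi * w) ^ 2 / 2) := by
  have h := congrFun (fourier_gaussian_pi (b := ((2 * Real.pi)⁻¹ : ℝ))
    (by rw [Complex.ofReal_re]; positivity)) w
  have hp := Real.pi_pos
  convert h using 1
  · refine congrArg _ (funext fun t => ?_)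
    push_cast
    field_simp
  · congr 1
    · rw [← Complex.ofReal_one, ← Complex.ofReal_ofNat, ← Complex.ofReal_div,
        ← Complex.ofReal_cpow (by positivity), ← Complex.ofReal_div, Real.sqrt_eq_rpow,
        Real.inv_rpow (by positivity)]
      simp
    · push_cast
      congr 1
      field_simp

/-- The creation operator `φ ↦ tφ - φ'` sends `H_n e^(-t²/2)` to `H_(n+1) e^(-t²/2)`. In angular
frequency the Fourier transform exchanges multiplication and differentiation, so it carries this
operator to `-i` times itself. -/
lemma fourier_physHermite (n : ℕ) (w : ℝ) :
    𝓕 (fun t : ℝ => (((physHermite n).eval t * Real.exp (-t ^ 2 / 2) : ℝ) : ℂ)) w =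
      √(2 * Real.pi) * (-Complex.I) ^ n * (((physHermite n).eval (2 * Real.pi * w) *
        Real.exp (-(2 * Real.pi * w) ^ 2 / 2) : ℝ) : ℂ) := by
  induction n generalizing w with
  | zero => simpa [physHermite] using fourier_gaussian_half w
  | succ n ih =>
    set φ : ℝ → ℂ := fun t => (((physHermite n).eval t * Real.exp (-t ^ 2 / 2) : ℝ) : ℂ) with hφ
    set ψ : ℝ → ℂ := fun t => (((physHermite (n + 1)).eval t * Real.exp (-t ^ 2 / 2) : ℝ) : ℂ)
      with hψ
    have hd (t : ℝ) : HasDerivAt φ (t * φ t - ψ t) t := by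
      convert! (hasDerivAt_hermiteFn_aux n t).ofReal_comp using 1
      simp only [hφ, hψ]; push_cast; ring
    have hint : Integrable φ := integrable_eval_mul_exp_half _
    have hint' : Integrable ψ := integrable_eval_mul_exp_half _
    have hX : Integrable (fun t : ℝ => t • φ t) := by
      refine (integrable_eval_mul_exp_half (Polynomial.X * physHermite n)).congr
        (ae_of_all _ fun t => ?_)
      simp only [hφ, Complex.real_smul, Polynomial.eval_mul, Polynomial.eval_X]; push_cast; ring
    have hderiv : deriv φ = fun t : ℝ => t • φ t - ψ t := funext fun t => (hd t).deriv
    have h1 := congrFun (Real.fourier_deriv hint (fun t => (hd t).differentiableAt)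
      (by rw [hderiv]; exact hX.sub hint')) w
    have h2 := Real.hasDerivAt_fourier hint hX w
    have h3 : 𝓕 φ = fun w => √(2 * Real.pi) * (-Complex.I) ^ n * φ (2 * Real.pi * w) :=
      funext ih
    have h4 : HasDerivAt (𝓕 φ) (√(2 * Real.pi) * (-Complex.I) ^ n * ((2 * Real.pi) *
        ((2 * Real.pi * w) * φ (2 * Real.pi * w) - ψ (2 * Real.pi * w)))) w := by
      rw [h3]
      have := (HasDerivAt.scomp w (hd (2 * Real.pi * w))
        ((hasDerivAt_id w).const_mul (2 * Real.pi)))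
      convert! this.const_mul (√(2 * Real.pi) * (-Complex.I) ^ n) using 1
      simp
    -- Two values of the derivative of `𝓕 φ`: the transform of `-2πi t φ`, and the derivative of the
    -- induction hypothesis.
    have h5 := h2.unique h4
    have h6 : 𝓕 (fun x : ℝ => (-2 * Real.pi * Complex.I * x) • φ x) w =
        (-2 * Real.pi * Complex.I) * 𝓕 (fun t : ℝ => t • φ t) w := by
      simp only [Real.fourier_real_eq_integral_exp_smul]
      rw [← integral_const_mul]
      refine integral_congr_ae (ae_of_all _ fun t => ?_)
      simp only [smul_eq_mul, Complex.real_smul]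
      ring
    have h7 : 𝓕 (deriv φ) w = 𝓕 (fun t : ℝ => t • φ t) w - 𝓕 ψ w := by
      rw [hderiv]
      simp only [Real.fourier_eq]
      rw [← integral_sub ((Real.fourierIntegral_convergent_iff w).2 hX)
        ((Real.fourierIntegral_convergent_iff w).2 hint')]
      simp only [smul_sub]
    rw [h6] at h5
    rw [h7, h3, smul_eq_mul] at h1
    change 𝓕 ψ w = √(2 * Real.pi) * (-Complex.I) ^ (n + 1) * ψ (2 * Real.pi * w)
    have hp : (Real.pi : ℂ) ≠ 0 := by exact_mod_cast Real.pi_ne_zero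
    apply mul_left_cancel₀ (mul_ne_zero two_ne_zero hp)
    rw [pow_succ]
    linear_combination (-2 * Real.pi : ℂ) * h1 + Complex.I * h5 +
      2 * Real.pi * 𝓕 (fun t : ℝ => t • φ t) w * Complex.I_sq

lemma integral_hermiteFn_mul_exp (n : ℕ) (x : ℝ) :
    ∫ t : ℝ, Complex.exp ((-(x * t) : ℝ) * Complex.I) * (hermiteFn n t : ℂ) =
      √(2 * Real.pi) * (-Complex.I) ^ n * hermiteFn n x := by
  have h := fourier_physHermite n (x / (2 * Real.pi))
  have hp := Real.pi_pos
  rw [mul_div_cancel₀ x (by positivity), Real.fourier_real_eq_integral_exp_smul] at h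
  have h2 := congrArg (fun z => (hermiteNormalizer n : ℂ) * z) h
  rw [← integral_const_mul] at h2
  convert h2 using 1
  · refine integral_congr_ae (ae_of_all _ fun t => ?_)
    have : -2 * Real.pi * t * (x / (2 * Real.pi)) = -(x * t) := by field_simp
    simp only [hermiteFn, this, smul_eq_mul]
    push_cast
    ring
  · simp only [hermiteFn]
    push_cast
    ring

/-! ### Factorization of the Hermite functions on `ℝ^d` -/

lemma partialD_prod {d : ℕ} (u : Fin d → ℝ → ℝ) (j : Fin d) :
    partialD j (fun x => ∏ i, u i (x i)) =
      fun x => ∏ i, Function.update u j (deriv (u j)) i (x i) := by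
  ext x
  have e (t : ℝ) : ∏ i, u i ((x + t • EuclideanSpace.single j (1 : ℝ)) i) =
      u j (x j + t) * ∏ i ∈ Finset.univ.erase j, u i (x i) := by
    rw [← Finset.mul_prod_erase _ _ (Finset.mem_univ j)]
    congr 1
    · simp
    · refine Finset.prod_congr rfl fun i hi => ?_
      simp [Finset.ne_of_mem_erase hi]
  simp only [partialD, lineDeriv, e]
  rw [deriv_mul_const_field, deriv_comp_const_add, add_zero,
    ← Finset.mul_prod_erase _ _ (Finset.mem_univ j), Function.update_self]
  congr 1
  refine Finset.prod_congr rfl fun i hi => ?_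
  rw [Function.update_of_ne (Finset.ne_of_mem_erase hi)]

lemma iterate_partialD_prod {d : ℕ} (u : Fin d → ℝ → ℝ) (j : Fin d) (n : ℕ) :
    (partialD j)^[n] (fun x => ∏ i, u i (x i)) =
      fun x => ∏ i, Function.update u j (deriv^[n] (u j)) i (x i) := by
  induction n with
  | zero => simp
  | succ n ih =>
    rw [Function.iterate_succ_apply', ih, partialD_prod, Function.update_idem,
      Function.update_self, Function.iterate_succ_apply']

lemma foldr_partialD_prod {d : ℕ} (α : Fin d → ℕ) (u : Fin d → ℝ → ℝ) (l : List (Fin d))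
    (hl : l.Nodup) :
    l.foldr (fun j u => (partialD j)^[α j] u) (fun x => ∏ i, u i (x i)) =
      fun x => ∏ i, (if i ∈ l then deriv^[α i] (u i) else u i) (x i) := by
  induction l with
  | nil => simp
  | cons j l ih =>
    rw [List.nodup_cons] at hl
    rw [List.foldr_cons, ih hl.2, iterate_partialD_prod]
    ext x
    refine Finset.prod_congr rfl fun i _ => ?_
    rcases eq_or_ne i j with rfl | h
    · simp [hl.1]
    · simp [h]

lemma multiPartialD_prod {d : ℕ} (α : Fin d → ℕ) (u : Fin d → ℝ → ℝ) :
    multiPartialD α (fun x => ∏ i, u i (x i)) = fun x => ∏ i, (deriv^[α i] (u i)) (x i) := by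
  rw [multiPartialD, foldr_partialD_prod α u _ (List.nodup_finRange d)]
  simp

/-- `e^(-|x|²)` is a product of functions of one variable, so the mixed derivative and all
normalizing factors split. From here on only one-variable facts about Hermite functions are needed.
-/
lemma hermiteFun_eq_prod {d : ℕ} (α : Fin d → ℕ) (x : EuclideanSpace ℝ (Fin d)) :
    hermiteFun α x = ∏ i, hermiteFn (α i) (x i) := by
  have hn (y : EuclideanSpace ℝ (Fin d)) : ‖y‖ ^ 2 = ∑ i, y i ^ 2 := by
    simp [EuclideanSpace.norm_sq_eq]
  have h1 : (fun y : EuclideanSpace ℝ (Fin d) => Real.exp (-‖y‖ ^ 2)) =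
      fun y => ∏ i, (fun t : ℝ => Real.exp (-t ^ 2)) (y i) := by
    ext y
    rw [hn, ← Finset.sum_neg_distrib, Real.exp_sum]
  have h2 : Real.exp (‖x‖ ^ 2 / 2) = ∏ i, Real.exp (x i ^ 2 / 2) := by
    rw [hn, Finset.sum_div, Real.exp_sum]
  have h3 : Real.pi ^ (-(d : ℝ) / 4) = ∏ _i : Fin d, Real.pi ^ (-(1 : ℝ) / 4) := by
    rw [Finset.prod_const, Finset.card_univ, Fintype.card_fin,
      ← Real.rpow_mul_natCast Real.pi_pos.le]
    congr 1; ring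
  have h4 : ((2 : ℝ) ^ multiLength α * (multiFactorial α : ℝ)) ^ (-(1 / 2) : ℝ) =
      ∏ i, ((2 : ℝ) ^ α i * ((α i).factorial : ℝ)) ^ (-(1 / 2) : ℝ) := by
    rw [multiLength, multiFactorial, ← Finset.prod_pow_eq_pow_sum, Nat.cast_prod,
      ← Finset.prod_mul_distrib, Real.finsetProd_rpow _ _ fun i _ => by positivity]
  have h5 : (-1 : ℝ) ^ multiLength α = ∏ i, (-1 : ℝ) ^ α i := by
    rw [multiLength, Finset.prod_pow_eq_pow_sum]
  rw [hermiteFun, h1, multiPartialD_prod α (fun _ t => Real.exp (-t ^ 2)), h2, h3, h4, h5,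
    ← Finset.prod_mul_distrib,
    ← Finset.prod_mul_distrib, ← Finset.prod_mul_distrib, ← Finset.prod_mul_distrib]
  refine Finset.prod_congr rfl fun i _ => ?_
  rw [iterate_deriv_gaussian, hermiteFn, hermiteNormalizer]
  have e1 : Real.exp (-(x i) ^ 2 / 2) = Real.exp (x i ^ 2 / 2) * Real.exp (-(x i) ^ 2) := by
    rw [← Real.exp_add]; ring_nf
  have e2 : (√(√Real.pi * (2 ^ α i * (α i).factorial)))⁻¹ =
      Real.pi ^ (-(1 : ℝ) / 4) * ((2 : ℝ) ^ α i * ((α i).factorial : ℝ)) ^ (-(1 / 2) : ℝ) := by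
    rw [Real.sqrt_eq_rpow, ← Real.rpow_neg (by positivity), Real.mul_rpow (by positivity)
      (by positivity), Real.sqrt_eq_rpow, ← Real.rpow_mul Real.pi_pos.le]
    norm_num
  have e3 : (-1 : ℝ) ^ α i * (-1) ^ α i = 1 := by rw [← mul_pow]; norm_num
  rw [e1, e2]
  linear_combination (Real.pi ^ (-(1 : ℝ) / 4) *
    ((2 : ℝ) ^ α i * ((α i).factorial : ℝ)) ^ (-(1 / 2) : ℝ) * Real.exp (x i ^ 2 / 2) *
    (physHermite (α i)).eval (x i) * Real.exp (-(x i) ^ 2)) * e3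

/-! ### Integrals of tensor products -/

section Tensor

variable {d : ℕ} {𝕜 : Type*} [RCLike 𝕜]

lemma integrable_tensor {u : Fin d → ℝ → 𝕜} (h : ∀ i, Integrable (u i)) :
    Integrable (fun x : EuclideanSpace ℝ (Fin d) => ∏ i, u i (x i)) := by
  rw [← (PiLp.volume_preserving_toLp (Fin d)).integrable_comp_emb
    (MeasurableEquiv.toLp 2 _).measurableEmbedding]
  exact Integrable.fintype_prod h

lemma integral_tensor (u : Fin d → ℝ → 𝕜) :
    ∫ x : EuclideanSpace ℝ (Fin d), ∏ i, u i (x i) = ∏ i, ∫ t, u i t := by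
  rw [← (PiLp.volume_preserving_toLp (Fin d)).integral_comp
    (MeasurableEquiv.toLp 2 _).measurableEmbedding]
  exact integral_fintype_prod_volume_eq_prod u

lemma aestronglyMeasurable_tensor {u : Fin d → ℝ → 𝕜} (h : ∀ i, AEStronglyMeasurable (u i)) :
    AEStronglyMeasurable (fun x : EuclideanSpace ℝ (Fin d) => ∏ i, u i (x i)) := by
  refine Finset.aestronglyMeasurable_fun_prod _ fun i _ => (h i).comp_quasiMeasurePreserving ?_
  exact (Measure.quasiMeasurePreserving_eval (fun _ => volume) i).comp
    (PiLp.volume_preserving_ofLp (Fin d)).quasiMeasurePreserving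

lemma memLp_tensor {u : Fin d → ℝ → 𝕜} (h : ∀ i, MemLp (u i) 2) :
    MemLp (fun x : EuclideanSpace ℝ (Fin d) => ∏ i, u i (x i)) 2 := by
  rw [memLp_two_iff_integrable_sq_norm (aestronglyMeasurable_tensor fun i => (h i).1)]
  have := integrable_tensor (u := fun i t => ‖u i t‖ ^ 2)
    (fun i => (memLp_two_iff_integrable_sq_norm (h i).1).1 (h i))
  simpa [norm_prod, Finset.prod_pow] using this

end Tensor

/-! ### Completeness of the Hermite functions -/

/-- Each test function is the transform of a Schwartz function, so the multiplication formula moves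
the transform onto `g`, where it vanishes. -/
lemma ae_eq_zero_of_fourier_eq_zero {E : Type*} [NormedAddCommGroup E] [InnerProductSpace ℝ E]
    [FiniteDimensional ℝ E] [MeasurableSpace E] [BorelSpace E] {g : E → ℂ} (hg : Integrable g)
    (h : ∀ w, 𝓕 g w = 0) : ∀ᵐ x, g x = 0 := by
  apply ae_eq_zero_of_integral_contDiff_smul_eq_zero hg.locallyIntegrable
  intro φ hφ hφc
  have h1 : HasCompactSupport (Complex.ofRealCLM ∘ φ) := hφc.comp_left rfl
  have h2 : ContDiff ℝ _ (Complex.ofRealCLM ∘ φ) := Complex.ofRealCLM.contDiff.comp hφ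
  let Φ : SchwartzMap E ℂ := h1.toSchwartzMap h2
  have h3 := VectorFourier.integral_fourierIntegral_smul_eq_flip (L := innerₗ E)
    Real.continuous_fourierChar continuous_inner
    (SchwartzMap.integrable (μ := volume) (𝓕⁻ Φ)) hg
  have h4 : 𝓕 (𝓕⁻ Φ) = Φ := by simp
  have h5 (x : E) : 𝓕 ((𝓕⁻ Φ : SchwartzMap E ℂ) : E → ℂ) x = φ x := by
    rw [← SchwartzMap.fourier_coe, h4]; rfl
  have h6 : ∫ x, 𝓕 ((𝓕⁻ Φ : SchwartzMap E ℂ) : E → ℂ) x • g x = 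
      ∫ x, (𝓕⁻ Φ : SchwartzMap E ℂ) x • 𝓕 g x := by
    simpa [flip_innerₗ] using! h3
  simpa [h5, h] using h6

lemma memLp_two_exp_neg_mul_sq {b : ℝ} (hb : 0 < b) :
    MemLp (fun t : ℝ => Real.exp (-b * t ^ 2)) 2 := by
  rw [memLp_two_iff_integrable_sq (by fun_prop)]
  refine (integrable_exp_neg_mul_sq (b := 2 * b) (by positivity)).congr (ae_of_all _ fun t => ?_)
  dsimp only
  rw [← Real.exp_nat_mul]
  congr 1; push_cast; ring

/-- The cross term obeys `√2 (Re z) t ≤ a t² + (Re z)²/(2a)`. The weight `a` is free: `1/4` gives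
square integrability, while `1 - 2λ` is matched to Gaussian decay of `f`. -/
lemma norm_bargmannKernel_le (z : ℂ) (t : ℝ) {a : ℝ} (ha : 0 < a) :
    ‖bargmannKernel z t‖ ≤
      Real.exp ((z.im ^ 2 - z.re ^ 2) / 2 + z.re ^ 2 / (2 * a)) *
        Real.exp ((a - 1 / 2) * t ^ 2) := by
  rw [norm_bargmannKernel, ← Real.exp_add]
  refine (mul_le_of_le_one_left (Real.exp_nonneg _) inv_sqrt_sqrt_pi_le_one).trans ?_
  apply Real.exp_le_exp.2
  have h2 : √2 ^ 2 = (2 : ℝ) := Real.sq_sqrt (by norm_num)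
  have e : a * t ^ 2 + z.re ^ 2 / (2 * a) - √2 * z.re * t = (√2 * a * t - z.re) ^ 2 / (2 * a) := by
    field_simp
    ring_nf
    rw [h2]
  have : 0 ≤ (√2 * a * t - z.re) ^ 2 / (2 * a) := by positivity
  linarith

lemma memLp_bargmannKernel (z : ℂ) : MemLp (bargmannKernel z) 2 := by
  refine ((memLp_two_exp_neg_mul_sq (b := 1 / 4) (by norm_num)).const_mul
    (Real.exp ((z.im ^ 2 - z.re ^ 2) / 2 + z.re ^ 2 / (2 * (1 / 4))))).mono
    (by fun_prop) (ae_of_all _ fun t => ?_)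
  refine (norm_bargmannKernel_le z t (a := 1 / 4) (by norm_num)).trans ?_
  rw [Real.norm_of_nonneg (by positivity)]
  norm_num

lemma memLp_hermiteFn (n : ℕ) : MemLp (fun t => (hermiteFn n t : ℂ)) 2 := by
  have : MemLp (hermiteFn n) 2 := by
    rw [memLp_two_iff_integrable_sq (by fun_prop)]
    simpa [sq] using integrable_hermiteFn_mul n n
  exact this.ofReal

lemma integral_norm_sq_hermiteFn (n : ℕ) : ∫ t, ‖(hermiteFn n t : ℂ)‖ ^ 2 = 1 := by
  simpa [sq] using integral_hermiteFn_mul n n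

lemma summable_pow_div_sqrt_factorial (x : ℝ) :
    Summable (fun n : ℕ => x ^ n / √n.factorial) := by
  have h := ((summable_geometric_of_lt_one (r := (1 / 4 : ℝ)) (by norm_num) (by norm_num)).add
    (Real.summable_pow_div_factorial (4 * x ^ 2)))
  refine h.of_norm_bounded fun n => ?_
  have hf : √(n.factorial : ℝ) ^ 2 = n.factorial := Real.sq_sqrt (by positivity)
  have hf0 : 0 < √(n.factorial : ℝ) := by positivity
  -- Splitting off `2^(-n)` allows `|ab| ≤ a² + b²`, whose two terms are a geometric and an
  -- exponential series.
  have e : x ^ n / √n.factorial = (1 / 2 : ℝ) ^ n * ((2 * x) ^ n / √n.factorial) := by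
    rw [mul_pow, ← mul_div_assoc, ← mul_assoc, ← mul_pow]; norm_num
  have e1 : (1 / 4 : ℝ) ^ n = ((1 / 2 : ℝ) ^ n) ^ 2 := by
    rw [← pow_mul, mul_comm, pow_mul]; norm_num
  have e2 : (4 * x ^ 2) ^ n / n.factorial = ((2 * x) ^ n / √n.factorial) ^ 2 := by
    rw [div_pow, hf, ← pow_mul, mul_comm n, pow_mul]; ring_nf
  rw [e, e1, e2, norm_mul, Real.norm_eq_abs, Real.norm_eq_abs]
  nlinarith [sq_nonneg (|(1 / 2 : ℝ) ^ n| - |(2 * x) ^ n / √n.factorial|),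
    sq_abs ((1 / 2 : ℝ) ^ n), sq_abs ((2 * x) ^ n / √n.factorial),
    abs_nonneg ((1 / 2 : ℝ) ^ n), abs_nonneg ((2 * x) ^ n / √n.factorial)]

section Pairing

variable {d : ℕ}

/-- The bilinear pairing of an `L²` function with a tensor product of functions of one variable. -/
noncomputable def tensorPairing (f : L2 d) (u : Fin d → ℝ → ℂ) : ℂ := ∫ x, f x * ∏ i, u i (x i)

lemma memLp_update {u : Fin d → ℝ → ℂ} (hu : ∀ i, MemLp (u i) 2) (j : Fin d) {v : ℝ → ℂ}
    (hv : MemLp v 2) (i : Fin d) : MemLp (Function.update u j v i) 2 := by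
  rcases eq_or_ne i j with rfl | h
  · simpa using hv
  · simpa [h] using hu i

lemma integrable_mul_tensor (f : L2 d) {u : Fin d → ℝ → ℂ} (hu : ∀ i, MemLp (u i) 2) :
    Integrable (fun x => f x * ∏ i, u i (x i)) :=
  (Lp.memLp f).integrable_mul (memLp_tensor hu)

lemma prod_update_apply (u : Fin d → ℝ → ℂ) (j : Fin d) (v : ℝ → ℂ)
    (x : EuclideanSpace ℝ (Fin d)) : ∏ i, Function.update u j v i (x i) =
      v (x j) * ∏ i ∈ Finset.univ.erase j, u i (x i) := by
  rw [← Finset.mul_prod_erase _ _ (Finset.mem_univ j), Function.update_self]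
  congr 1
  refine Finset.prod_congr rfl fun i hi => ?_
  rw [Function.update_of_ne (Finset.ne_of_mem_erase hi)]

lemma integral_norm_mul_tensor_le (f : L2 d) {u : Fin d → ℝ → ℂ} (hu : ∀ i, MemLp (u i) 2) :
    ∫ x, ‖f x * ∏ i, u i (x i)‖ ≤
      ((∫ x, ‖f x‖ ^ 2) + ∏ i, ∫ t, ‖u i t‖ ^ 2) / 2 := by
  have h1 := (memLp_two_iff_integrable_sq_norm (Lp.memLp f).1).1 (Lp.memLp f)
  have h2 := (memLp_two_iff_integrable_sq_norm (memLp_tensor hu).1).1 (memLp_tensor hu)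
  rw [← integral_tensor (fun i t => ‖u i t‖ ^ 2)]
  have e (x : EuclideanSpace ℝ (Fin d)) : ∏ i, ‖u i (x i)‖ ^ 2 = ‖∏ i, u i (x i)‖ ^ 2 := by
    rw [norm_prod, Finset.prod_pow]
  simp only [e]
  rw [← integral_add h1 h2, ← integral_div]
  refine integral_mono (integrable_mul_tensor f hu).norm ((h1.add h2).div_const 2) fun x => ?_
  dsimp only
  rw [norm_mul]
  nlinarith [sq_nonneg (‖f x‖ - ‖∏ i, u i (x i)‖)]

/-- The kernel expansion may be integrated term by term: since the Hermite functions are normalized,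
the pairings are bounded uniformly in `n`, and `∑ |z|^n/√n!` converges. -/
lemma hasSum_tensorPairing (f : L2 d) {u : Fin d → ℝ → ℂ} (hu : ∀ i, MemLp (u i) 2) (j : Fin d)
    (z : ℂ) :
    HasSum (fun n : ℕ => z ^ n * (((√n.factorial : ℝ) : ℂ)⁻¹ *
        tensorPairing f (Function.update u j fun t => (hermiteFn n t : ℂ))))
      (tensorPairing f (Function.update u j (bargmannKernel z))) := by
  have hmem (n : ℕ) := memLp_update hu j (memLp_hermiteFn n)
  have hint (n : ℕ) := integrable_mul_tensor f (hmem n)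
  have hs := hasSum_integral_of_summable_integral_norm
    (F := fun (n : ℕ) x => (z ^ n / (√n.factorial : ℝ)) *
      (f x * ∏ i, Function.update u j (fun t => (hermiteFn n t : ℂ)) i (x i)))
    (μ := (volume : Measure (EuclideanSpace ℝ (Fin d))))
    (fun n => (hint n).const_mul _) ?_
  · convert! hs using 1
    · ext n
      rw [integral_const_mul, tensorPairing]; ring
    · refine integral_congr_ae (ae_of_all _ fun x => ?_)
      dsimp only
      refine (HasSum.tsum_eq ?_).symm
      have := (hasSum_hermiteFn z (x j)).mul_right (f x * ∏ i ∈ Finset.univ.erase j, u i (x i))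
      convert! this using 1
      · ext n; rw [prod_update_apply]; ring
      · rw [prod_update_apply]; ring
  · have hB (n : ℕ) : ∏ i, ∫ t, ‖Function.update u j (fun t => (hermiteFn n t : ℂ)) i t‖ ^ 2 =
        ∏ i ∈ Finset.univ.erase j, ∫ t, ‖u i t‖ ^ 2 := by
      rw [← Finset.mul_prod_erase _ _ (Finset.mem_univ j), Function.update_self,
        integral_norm_sq_hermiteFn, one_mul]
      refine Finset.prod_congr rfl fun i hi => ?_
      rw [Function.update_of_ne (Finset.ne_of_mem_erase hi)]
    refine Summable.of_nonneg_of_le (fun n => integral_nonneg fun x => norm_nonneg _) (fun n => ?_)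
      ((summable_pow_div_sqrt_factorial ‖z‖).mul_right
        (((∫ x, ‖f x‖ ^ 2) + ∏ i ∈ Finset.univ.erase j, ∫ t, ‖u i t‖ ^ 2) / 2))
    simp_rw [norm_mul (_ / _)]
    rw [integral_const_mul, ← hB n, norm_div, norm_pow, Complex.norm_real,
      Real.norm_of_nonneg (Real.sqrt_nonneg _)]
    gcongr
    exact integral_norm_mul_tensor_le f (hmem n)

lemma hermiteCoeff_eq_tensorPairing (f : L2 d) (α : Fin d → ℕ) :
    hermiteCoeff f α = tensorPairing f (fun i t => (hermiteFn (α i) t : ℂ)) := by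
  simp [hermiteCoeff, tensorPairing, hermiteFun_eq_prod]

/-- Hermite functions are traded for kernels one coordinate at a time: the pairing with a kernel is
a power series whose coefficients all vanish by induction. -/
lemma tensorPairing_eq_zero (f : L2 d) (h : ∀ α, hermiteCoeff f α = 0) (z : Fin d → ℂ)
    (S : Finset (Fin d)) (α : Fin d → ℕ) :
    tensorPairing f (fun i => if i ∈ S then bargmannKernel (z i)
      else fun t => (hermiteFn (α i) t : ℂ)) = 0 := by
  induction S using Finset.induction_on generalizing α with
  | empty => simpa [hermiteCoeff_eq_tensorPairing] using h α
  | insert j S hj ih =>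
    set u : Fin d → ℝ → ℂ := fun i => if i ∈ S then bargmannKernel (z i)
      else fun t => (hermiteFn (α i) t : ℂ) with hu
    have hmem (i : Fin d) : MemLp (u i) 2 := by
      simp only [hu]; split_ifs
      · exact memLp_bargmannKernel _
      · exact memLp_hermiteFn _
    have h1 := hasSum_tensorPairing f hmem j (z j)
    have h2 (n : ℕ) :
        tensorPairing f (Function.update u j fun t => (hermiteFn n t : ℂ)) = 0 := by
      rw [← ih (Function.update α j n)]
      congr 1
      ext i t
      rcases eq_or_ne i j with rfl | hi
      · simp [hj]
      · simp [hi, hu]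
    simp only [h2, mul_zero] at h1
    rw [← h1.unique hasSum_zero]
    congr 1
    ext i t
    rcases eq_or_ne i j with rfl | hi
    · simp
    · simp [hi, hu]

lemma bargmannKernel_imaginary (w t : ℝ) :
    bargmannKernel (-Complex.I * (√2 * Real.pi * w : ℝ)) t =
      ((√(√Real.pi))⁻¹ * Real.exp ((√2 * Real.pi * w) ^ 2 / 2) : ℝ) *
        (Complex.exp ((-2 * Real.pi * (t * w) : ℝ) * Complex.I) * Real.exp (-t ^ 2 / 2)) := by
  have h2 : ((√2 : ℝ) : ℂ) ^ 2 = 2 := by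
    rw [← Complex.ofReal_pow, Real.sq_sqrt (by norm_num)]; norm_num
  rw [bargmannKernel]
  push_cast
  rw [← Complex.exp_add, mul_assoc (_⁻¹), ← Complex.exp_add]
  congr 2
  rw [mul_pow, neg_sq, Complex.I_sq]
  linear_combination (-Complex.I * Real.pi * w * t) * h2

/-- At purely imaginary points the Bargmann kernel is a nonzero constant times a character times
`e^(-t²/2)`. Vanishing coefficients therefore make the Fourier transform of `f e^(-|x|²/2)` vanish.
-/
theorem eq_zero_of_hermiteCoeff_eq_zero (f : L2 d) (h : ∀ α, hermiteCoeff f α = 0) : f = 0 := by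
  set G : EuclideanSpace ℝ (Fin d) → ℂ := fun x => ∏ i, ((Real.exp (-(x i) ^ 2 / 2) : ℝ) : ℂ)
    with hG
  have hG0 (x) : G x ≠ 0 := Finset.prod_ne_zero_iff.2 fun i _ => by
    exact_mod_cast (Real.exp_pos _).ne'
  have hmem (i : Fin d) : MemLp (fun t : ℝ => ((Real.exp (-t ^ 2 / 2) : ℝ) : ℂ)) 2 := by
    have : MemLp (fun t : ℝ => Real.exp (-t ^ 2 / 2)) 2 := by
      convert memLp_two_exp_neg_mul_sq (b := 1 / 2) (by norm_num) using 3
      ring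
    exact this.ofReal
  have hint : Integrable (fun x => f x * G x) :=
    integrable_mul_tensor f (u := fun _ t => ((Real.exp (-t ^ 2 / 2) : ℝ) : ℂ)) hmem
  have h0 : ∀ᵐ x, f x * G x = 0 := by
    refine ae_eq_zero_of_fourier_eq_zero hint fun w => ?_
    have h1 := tensorPairing_eq_zero f h
      (fun i => -Complex.I * (√2 * Real.pi * w i : ℝ)) Finset.univ 0
    simp only [Finset.mem_univ, if_true, tensorPairing, bargmannKernel_imaginary,
      Finset.prod_mul_distrib] at h1
    simp_rw [mul_left_comm (f _)] at h1
    rw [integral_const_mul, mul_eq_zero] at h1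
    rcases h1 with h1 | h1
    · exfalso
      rw [Finset.prod_eq_zero_iff] at h1
      obtain ⟨i, -, hi⟩ := h1
      have : 0 < (√(√Real.pi))⁻¹ * Real.exp ((√2 * Real.pi * w i) ^ 2 / 2) := by positivity
      exact this.ne' (by exact_mod_cast hi)
    · rw [Real.fourier_eq', ← h1]
      refine integral_congr_ae (ae_of_all _ fun x => ?_)
      dsimp only
      rw [← Complex.exp_sum, ← Finset.sum_mul, smul_eq_mul, ← Complex.ofReal_sum,
        ← Finset.mul_sum]
      congr 4
      simp [PiLp.inner_apply, mul_comm]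
  rw [Lp.eq_zero_iff_ae_eq_zero]
  filter_upwards [h0] with x hx
  simpa [hG0 x] using hx

end Pairing

/-! ### The Hermite basis, the Pilipović space and the Gaussian bound for Hermite series -/

section Basis

variable {d : ℕ}

lemma memLp_hermiteFun (α : Fin d → ℕ) :
    MemLp (fun x : EuclideanSpace ℝ (Fin d) => (hermiteFun α x : ℂ)) 2 := by
  simp only [hermiteFun_eq_prod, Complex.ofReal_prod]
  exact memLp_tensor fun i => memLp_hermiteFn (α i)

/-- The Hermite functions as elements of `L²`. -/
noncomputable def hermiteLp (α : Fin d → ℕ) : L2 d := (memLp_hermiteFun α).toLp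

lemma coeFn_hermiteLp (α : Fin d → ℕ) :
    hermiteLp α =ᵐ[volume] fun x => (hermiteFun α x : ℂ) := MemLp.coeFn_toLp _

lemma inner_hermiteLp (f : L2 d) (α : Fin d → ℕ) :
    inner ℂ (hermiteLp α) f = hermiteCoeff f α := by
  rw [L2.inner_def, hermiteCoeff]
  refine integral_congr_ae ?_
  filter_upwards [coeFn_hermiteLp α] with x hx
  simp [hx]

lemma hermiteCoeff_hermiteLp (α β : Fin d → ℕ) :
    hermiteCoeff (hermiteLp β) α = if α = β then 1 else 0 := by
  have h1 : hermiteCoeff (hermiteLp β) α =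
      ∫ x : EuclideanSpace ℝ (Fin d),
        ∏ i, ((hermiteFn (β i) (x i) * hermiteFn (α i) (x i) : ℝ) : ℂ) := by
    refine integral_congr_ae ?_
    filter_upwards [coeFn_hermiteLp β] with x hx
    simp [hx, hermiteFun_eq_prod, Finset.prod_mul_distrib]
  rw [h1, integral_tensor (fun i t => ((hermiteFn (β i) t * hermiteFn (α i) t : ℝ) : ℂ))]
  simp_rw [integral_complex_ofReal, integral_hermiteFn_mul]
  split_ifs with h
  · subst h; simp
  · obtain ⟨i, hi⟩ := Function.ne_iff.1 h
    exact Finset.prod_eq_zero (Finset.mem_univ i) (by simp [Ne.symm hi])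

lemma orthonormal_hermiteLp : Orthonormal ℂ (hermiteLp (d := d)) := by
  rw [orthonormal_iff_ite]
  intro α β
  rw [inner_hermiteLp, hermiteCoeff_hermiteLp]

/-- The Hermite functions form a Hilbert basis of `L²(ℝ^d)`. -/
noncomputable def hermiteBasis (d : ℕ) : HilbertBasis (Fin d → ℕ) ℂ (L2 d) :=
  HilbertBasis.mkOfOrthogonalEqBot orthonormal_hermiteLp <| by
    rw [Submodule.eq_bot_iff]
    intro f hf
    refine eq_zero_of_hermiteCoeff_eq_zero f fun α => ?_
    rw [← inner_hermiteLp]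
    exact (Submodule.mem_orthogonal _ _).1 hf _ (Submodule.subset_span ⟨α, rfl⟩)

lemma hasSum_hermiteLp (f : L2 d) : HasSum (fun α => hermiteCoeff f α • hermiteLp α) f := by
  simpa [HilbertBasis.repr_apply_apply, hermiteBasis, inner_hermiteLp]
    using (hermiteBasis d).hasSum_repr f

lemma hasSum_hermiteLp_iff (f : L2 d) (c : (Fin d → ℕ) → ℂ) :
    HasSum (fun α => c α • hermiteLp α) f ↔
      Tendsto (fun s : Finset (Fin d → ℕ) =>
        eLpNorm (fun x => f x - ∑ α ∈ s, c α * (hermiteFun α x : ℂ)) 2 volume) atTop (𝓝 0) := by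
  rw [HasSum, tendsto_iff_edist_tendsto_0, SummationFilter.unconditional_filter]
  refine tendsto_congr fun s => ?_
  rw [edist_comm, Lp.edist_def]
  refine eLpNorm_congr_ae ?_
  have h1 : ((∑ α ∈ s, c α • hermiteLp α : L2 d) : EuclideanSpace ℝ (Fin d) → ℂ) =ᵐ[volume]
      fun x => ∑ α ∈ s, c α * (hermiteFun α x : ℂ) := by
    have h2 : ∀ᵐ x, ∀ α ∈ s, (c α • hermiteLp α : L2 d) x = c α * (hermiteFun α x : ℂ) := by
      refine (ae_ball_iff s.countable_toSet).2 fun α _ => ?_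
      filter_upwards [Lp.coeFn_smul (c α) (hermiteLp α), coeFn_hermiteLp α] with x h3 h4
      simp [h3, h4]
    filter_upwards [Lp.coeFn_finsetSum s fun α => c α • hermiteLp α, h2] with x h3 h4
    rw [h3, Finset.sum_apply]
    exact Finset.sum_congr rfl fun α hα => h4 α hα
  filter_upwards [h1] with x hx
  rw [Pi.sub_apply, hx]

theorem mem_pilipovicSpace_iff (f : L2 d) :
    f ∈ pilipovicSpace d ↔ SuperexpDecay (hermiteCoeff f) := by
  constructor
  · rintro ⟨c, hc, h⟩
    rw [← hasSum_hermiteLp_iff] at h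
    convert hc using 1
    ext α
    -- Pairing the series with `h_α` leaves only `c α`, so the given coefficients are the Hermite
    -- coefficients.
    have h1 := h.mapL (innerSL ℂ (hermiteLp α))
    rw [innerSL_apply_apply, inner_hermiteLp] at h1
    refine h1.unique ?_
    convert! hasSum_ite_eq α (c α) using 1
    ext β
    rw [innerSL_apply_apply, inner_smul_right, inner_hermiteLp, hermiteCoeff_hermiteLp]
    split_ifs with h2 h3 h3
    · rw [h2, mul_one]
    · exact absurd h2.symm h3
    · exact absurd h3.symm h2
    · simp
  · exact fun h => ⟨_, h, (hasSum_hermiteLp_iff f _).1 (hasSum_hermiteLp f)⟩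

lemma sum_exp_neg_multiLength_le (s : Finset (Fin d → ℕ)) :
    ∑ α ∈ s, Real.exp (-(multiLength α : ℝ)) ≤ ((1 - Real.exp (-1))⁻¹) ^ d := by
  have hlt : Real.exp (-1) < 1 := by rw [Real.exp_lt_one_iff]; norm_num
  set N : ℕ := s.sup multiLength + 1 with hN
  have hs : s ⊆ Fintype.piFinset fun _ => Finset.range N := by
    intro α hα
    rw [Fintype.mem_piFinset]
    intro i
    have h1 : α i ≤ multiLength α :=
      Finset.single_le_sum (fun _ _ => Nat.zero_le _) (Finset.mem_univ i)
    have h2 : multiLength α ≤ s.sup multiLength := Finset.le_sup hα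
    rw [Finset.mem_range]; omega
  have he (α : Fin d → ℕ) : Real.exp (-(multiLength α : ℝ)) = ∏ i, Real.exp (-1) ^ α i := by
    rw [Finset.prod_pow_eq_pow_sum, ← Real.exp_nat_mul, mul_neg_one, multiLength]
  calc ∑ α ∈ s, Real.exp (-(multiLength α : ℝ))
      ≤ ∑ α ∈ Fintype.piFinset fun _ => Finset.range N, Real.exp (-(multiLength α : ℝ)) :=
        Finset.sum_le_sum_of_subset_of_nonneg hs fun _ _ _ => (Real.exp_pos _).le
    _ = ∏ _i : Fin d, ∑ n ∈ Finset.range N, Real.exp (-1) ^ n := by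
        simp_rw [he]
        rw [Finset.prod_univ_sum]
    _ ≤ ∏ _i : Fin d, (1 - Real.exp (-1))⁻¹ := by
        refine Finset.prod_le_prod (fun _ _ => Finset.sum_nonneg fun _ _ => by positivity)
          fun _ _ => ?_
        rw [← tsum_geometric_of_lt_one (Real.exp_pos _).le hlt]
        exact (summable_geometric_of_lt_one (Real.exp_pos _).le hlt).sum_le_tsum _
          fun _ _ => by positivity
    _ = _ := by simp

lemma abs_hermiteFun_le (α : Fin d → ℕ) (x : EuclideanSpace ℝ (Fin d)) {ε : ℝ} (hε : 0 < ε) :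
    |hermiteFun α x| ≤ Real.exp ((multiLength α + d) * (1 / 2 + 1 / (2 * ε))) *
      Real.exp (-(1 / 2 - ε) * ‖x‖ ^ 2) := by
  rw [hermiteFun_eq_prod, Finset.abs_prod]
  refine (Finset.prod_le_prod (fun _ _ => abs_nonneg _)
    fun i _ => norm_hermiteFn_le (α i) (x i) hε).trans_eq ?_
  rw [Finset.prod_mul_distrib, ← Real.exp_sum, ← Real.exp_sum, ← Finset.sum_mul, ← Finset.mul_sum]
  simp [EuclideanSpace.norm_sq_eq, multiLength, Finset.sum_add_distrib]

theorem nearlyOptimalDecay_of_superexpDecay (f : L2 d) (h : SuperexpDecay (hermiteCoeff f)) :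
    NearlyOptimalDecay f (fun x => ‖x‖) := by
  intro μ hμ
  set A : ℝ := 1 / 2 + 1 / (2 * μ) with hA
  have hA0 : 0 < A := by positivity
  -- Rate `A` cancels the growth `e^(A|α|)` of the Hermite functions; the extra `1` leaves the
  -- summable factor `e^(-|α|)`.
  obtain ⟨C, hC⟩ := h (A + 1) (by positivity)
  have hC0 : 0 ≤ C := by
    have := (norm_nonneg _).trans (hC 0)
    exact nonneg_of_mul_nonneg_left this (Real.exp_pos _)
  refine ⟨C * Real.exp (d * A) * ((1 - Real.exp (-1))⁻¹) ^ d, ?_⟩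
  have h1 := (hasSum_hermiteLp_iff f _).1 (hasSum_hermiteLp f)
  -- `L²` convergence gives convergence in measure, hence almost everywhere along a sequence of
  -- finite sets; the partial sums obey one common Gaussian bound, which passes to the limit.
  have h2 : TendstoInMeasure volume
      (fun (s : Finset (Fin d → ℕ)) x => ∑ α ∈ s, hermiteCoeff f α * (hermiteFun α x : ℂ))
      atTop f := by
    refine tendstoInMeasure_of_tendsto_eLpNorm two_ne_zero (fun s => ?_) (Lp.memLp f).1 ?_
    · exact Finset.aestronglyMeasurable_fun_sum _ fun α _ => (memLp_hermiteFun α).1.const_mul _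
    · refine h1.congr fun s => ?_
      rw [eLpNorm_sub_comm]
      rfl
  obtain ⟨ns, -, hns⟩ := h2.exists_seq_tendsto_ae'
  filter_upwards [hns] with x hx
  refine le_of_tendsto hx.norm (Eventually.of_forall fun k => ?_)
  calc ‖∑ α ∈ ns k, hermiteCoeff f α * (hermiteFun α x : ℂ)‖
      ≤ ∑ α ∈ ns k, ‖hermiteCoeff f α * (hermiteFun α x : ℂ)‖ := norm_sum_le _ _
    _ ≤ ∑ α ∈ ns k, C * Real.exp (d * A) * Real.exp (-(1 / 2 - μ) * ‖x‖ ^ 2) *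
          Real.exp (-(multiLength α : ℝ)) := by
        refine Finset.sum_le_sum fun α _ => ?_
        rw [norm_mul, Complex.norm_real, Real.norm_eq_abs]
        refine (mul_le_mul (hC α) (abs_hermiteFun_le α x hμ) (abs_nonneg _)
          (by positivity)).trans_eq ?_
        have : Real.exp (-(A + 1) * (multiLength α : ℝ)) *
            Real.exp ((multiLength α + d) * A) =
            Real.exp (d * A) * Real.exp (-(multiLength α : ℝ)) := by
          rw [← Real.exp_add, ← Real.exp_add]; ring_nf
        linear_combination (C * Real.exp (-(1 / 2 - μ) * ‖x‖ ^ 2)) * this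
    _ ≤ C * Real.exp (d * A) * Real.exp (-(1 / 2 - μ) * ‖x‖ ^ 2) *
          ((1 - Real.exp (-1))⁻¹) ^ d := by
        rw [← Finset.mul_sum]
        gcongr
        exact sum_exp_neg_multiLength_le _
    _ = _ := by ring

lemma norm_hermiteCoeff_le (f : L2 d) (α : Fin d → ℕ) : ‖hermiteCoeff f α‖ ≤ ‖f‖ := by
  rw [← inner_hermiteLp]
  refine (norm_inner_le_norm _ _).trans_eq ?_
  rw [orthonormal_hermiteLp.1 α, one_mul]

end Basis

/-! ### The Fourier transform on `L²` and its action on Hermite coefficients -/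

section FourierL2

variable {E : Type*} [NormedAddCommGroup E] [InnerProductSpace ℝ E]
    [FiniteDimensional ℝ E] [MeasurableSpace E] [BorelSpace E]

lemma continuous_integral_mul_Lp {g : E → ℂ} (hg : MemLp g 2) :
    Continuous (fun f : Lp (α := E) ℂ 2 => ∫ x, f x * g x) := by
  have h : (fun f : Lp (α := E) ℂ 2 => ∫ x, f x * g x) = fun f => inner ℂ (hg.star.toLp) f := by
    ext f
    rw [L2.inner_def]
    refine integral_congr_ae ?_
    filter_upwards [hg.star.coeFn_toLp] with x hx
    simp [hx]
  rw [h]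
  fun_prop

/-- The multiplication formula for the Fourier transform on `L²`. -/
theorem integral_fourier_mul_eq_Lp (f : Lp (α := E) ℂ 2) {g : E → ℂ} (hg : Integrable g)
    (hg2 : MemLp g 2) (hg' : MemLp (𝓕 g) 2) :
    ∫ x, (𝓕 f : Lp (α := E) ℂ 2) x * g x = ∫ x, f x * 𝓕 g x := by
  -- Both sides are continuous in `f`, and on the dense set of Schwartz functions this is the
  -- classical formula.
  refine DenseRange.induction_on
    (p := fun f : Lp (α := E) ℂ 2 => ∫ x, (𝓕 f : Lp (α := E) ℂ 2) x * g x = ∫ x, f x * 𝓕 g x)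
    (SchwartzMap.denseRange_toLpCLM (p := 2) ENNReal.ofNat_ne_top) f ?_ fun φ => ?_
  · exact isClosed_eq ((continuous_integral_mul_Lp hg2).comp
      (Lp.fourierTransformₗᵢ E ℂ).continuous) (continuous_integral_mul_Lp hg')
  · have h := VectorFourier.integral_fourierIntegral_smul_eq_flip (L := innerₗ E)
      Real.continuous_fourierChar continuous_inner
      (SchwartzMap.integrable (μ := volume) φ) hg
    have h1 : ∫ x, (𝓕 (φ : E → ℂ)) x * g x = ∫ x, φ x * 𝓕 g x := by
      simpa [flip_innerₗ] using! h
    rw [SchwartzMap.toLpCLM_apply, SchwartzMap.toLp_fourier_eq]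
    convert h1 using 1
    · refine integral_congr_ae ?_
      filter_upwards [(𝓕 φ).coeFn_toLp 2] with x hx
      rw [hx, SchwartzMap.fourier_coe]
    · refine integral_congr_ae ?_
      filter_upwards [φ.coeFn_toLp 2] with x hx
      rw [hx]

lemma memLp_comp_smul {F : Type*} [NormedAddCommGroup F] {g : E → F} {p : ENNReal}
    (hg : MemLp g p) {r : ℝ} (hr : r ≠ 0) : MemLp (fun x => g (r • x)) p := by
  refine MemLp.comp_of_map (f := fun x : E => r • x) ?_ (by fun_prop)
  rw [Measure.map_addHaar_smul _ hr]
  exact hg.smul_measure ENNReal.ofReal_ne_top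

end FourierL2

section FourierHermite

variable {d : ℕ}

lemma memLp_fourierHat (f : L2 d) : MemLp (fourierHat f) 2 :=
  (memLp_comp_smul (Lp.memLp (𝓕 f : L2 d)) (by positivity)).const_mul _

lemma integral_exp_mul_hermiteFun (α : Fin d → ℕ) (x : EuclideanSpace ℝ (Fin d)) :
    ∫ ξ : EuclideanSpace ℝ (Fin d),
      Complex.exp ((-inner ℝ ξ x : ℝ) * Complex.I) * (hermiteFun α ξ : ℂ) =
      √(2 * Real.pi) ^ d * (-Complex.I) ^ multiLength α * hermiteFun α x := by
  have e (ξ : EuclideanSpace ℝ (Fin d)) :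
      Complex.exp ((-inner ℝ ξ x : ℝ) * Complex.I) * (hermiteFun α ξ : ℂ) =
      ∏ i, (fun t : ℝ => Complex.exp ((-(x i * t) : ℝ) * Complex.I) * (hermiteFn (α i) t : ℂ))
        (ξ i) := by
    rw [Finset.prod_mul_distrib, hermiteFun_eq_prod, Complex.ofReal_prod, ← Complex.exp_sum,
      ← Finset.sum_mul, ← Complex.ofReal_sum, Finset.sum_neg_distrib]
    simp [PiLp.inner_apply]
  simp_rw [e]
  rw [integral_tensor (fun i t => Complex.exp ((-(x i * t) : ℝ) * Complex.I) *
    (hermiteFn (α i) t : ℂ))]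
  simp_rw [integral_hermiteFn_mul_exp]
  rw [Finset.prod_mul_distrib, Finset.prod_mul_distrib, Finset.prod_pow_eq_pow_sum,
    hermiteFun_eq_prod, multiLength]
  simp

lemma integrable_hermiteFun (α : Fin d → ℕ) :
    Integrable (fun x : EuclideanSpace ℝ (Fin d) => (hermiteFun α x : ℂ)) := by
  simp only [hermiteFun_eq_prod, Complex.ofReal_prod]
  exact integrable_tensor fun i => (integrable_hermiteFn (α i)).ofReal

lemma fourier_hermiteFun_comp_smul (α : Fin d → ℕ) (x : EuclideanSpace ℝ (Fin d)) :
    𝓕 (fun η : EuclideanSpace ℝ (Fin d) => (hermiteFun α ((2 * Real.pi) • η) : ℂ)) x =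
      ((2 * Real.pi) ^ (-(d : ℝ) / 2) : ℝ) * (-Complex.I) ^ multiLength α * hermiteFun α x := by
  have h := Measure.integral_comp_smul_of_nonneg volume (fun ξ : EuclideanSpace ℝ (Fin d) =>
    Complex.exp ((-inner ℝ ξ x : ℝ) * Complex.I) * (hermiteFun α ξ : ℂ)) (2 * Real.pi)
    (hR := by positivity)
  rw [integral_exp_mul_hermiteFun, finrank_euclideanSpace_fin] at h
  rw [Real.fourier_eq']
  have h2 : ((2 * Real.pi) ^ d)⁻¹ * √(2 * Real.pi) ^ d = (2 * Real.pi) ^ (-(d : ℝ) / 2) := by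
    rw [Real.sqrt_eq_rpow, ← Real.rpow_mul_natCast (by positivity), ← Real.rpow_natCast,
      ← Real.rpow_neg (by positivity), ← Real.rpow_add (by positivity)]
    congr 1; ring
  have h3 : ((((2 * Real.pi) ^ d)⁻¹ : ℝ) : ℂ) * (√(2 * Real.pi) : ℂ) ^ d =
      ((2 * Real.pi) ^ (-(d : ℝ) / 2) : ℝ) := by
    rw [← h2]; push_cast; ring
  rw [← h3]
  convert! h using 1
  · refine integral_congr_ae (ae_of_all _ fun η => ?_)
    simp only [smul_eq_mul, real_inner_smul_left]
    congr 4
    ring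
  · rw [Complex.real_smul]; ring

/-- `fourierHat f` as an element of `L²`. -/
noncomputable def fourierHatLp (f : L2 d) : L2 d := (memLp_fourierHat f).toLp

lemma coeFn_fourierHatLp (f : L2 d) : fourierHatLp f =ᵐ[volume] fourierHat f :=
  MemLp.coeFn_toLp _

/-- The substitution `ξ = 2πη` moves the dilation from `𝓕 f` to the Hermite function, and the
multiplication formula then puts the transform on it. The powers of `2π` cancel: `(2π)^d` from the
substitution against two factors `(2π)^(-d/2)`. -/
theorem hermiteCoeff_fourierHatLp (f : L2 d) (α : Fin d → ℕ) :
    hermiteCoeff (fourierHatLp f) α = (-Complex.I) ^ multiLength α * hermiteCoeff f α := by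
  have hp : (0 : ℝ) < 2 * Real.pi := by positivity
  set c : ℝ := (2 * Real.pi) ^ (-(d : ℝ) / 2) with hc
  let G : EuclideanSpace ℝ (Fin d) → ℂ := fun η =>
    (c : ℂ) * ((𝓕 f : L2 d) η * (hermiteFun α ((2 * Real.pi) • η) : ℂ))
  have h1 : hermiteCoeff (fourierHatLp f) α =
      ∫ ξ : EuclideanSpace ℝ (Fin d), G ((2 * Real.pi)⁻¹ • ξ) := by
    refine integral_congr_ae ?_
    filter_upwards [coeFn_fourierHatLp f] with ξ hξ
    rw [hξ, fourierHat]
    simp only [G, smul_smul, mul_inv_cancel₀ hp.ne', one_smul]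
    ring
  have h2 : ((2 * Real.pi)⁻¹ ^ d)⁻¹ * (c * c) = 1 := by
    rw [hc, ← Real.rpow_add hp, inv_pow, inv_inv, ← Real.rpow_natCast, ← Real.rpow_add hp]
    ring_nf
    simp
  rw [h1, Measure.integral_comp_smul_of_nonneg volume G _ (hR := by positivity),
    integral_const_mul, finrank_euclideanSpace_fin]
  have h3 : 𝓕 (fun η : EuclideanSpace ℝ (Fin d) => (hermiteFun α ((2 * Real.pi) • η) : ℂ)) =
      fun x => (c : ℂ) * (-Complex.I) ^ multiLength α * hermiteFun α x :=
    funext (fourier_hermiteFun_comp_smul α)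
  have h4 := integral_fourier_mul_eq_Lp f
    (g := fun η : EuclideanSpace ℝ (Fin d) => (hermiteFun α ((2 * Real.pi) • η) : ℂ))
    ((integrable_hermiteFun α).comp_smul hp.ne')
    (memLp_comp_smul (memLp_hermiteFun α) hp.ne')
    (by rw [h3]; exact (memLp_hermiteFun α).const_mul _)
  rw [h4, h3]
  simp_rw [mul_left_comm (f _)]
  rw [integral_const_mul, Complex.real_smul, ← hermiteCoeff]
  have h5 : ((((2 * Real.pi)⁻¹ ^ d)⁻¹ : ℝ) : ℂ) * (c * c) = 1 := by exact_mod_cast h2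
  linear_combination ((-Complex.I) ^ multiLength α * hermiteCoeff f α) * h5

lemma superexpDecay_fourierHatLp (f : L2 d) (h : SuperexpDecay (hermiteCoeff f)) :
    SuperexpDecay (hermiteCoeff (fourierHatLp f)) := by
  intro r hr
  obtain ⟨C, hC⟩ := h r hr
  exact ⟨C, fun α => by simpa [hermiteCoeff_fourierHatLp] using hC α⟩

lemma NearlyOptimalDecay.congr {g g' : EuclideanSpace ℝ (Fin d) → ℂ}
    {ρ : EuclideanSpace ℝ (Fin d) → ℝ} (h : NearlyOptimalDecay g ρ) (hg : g =ᵐ[volume] g') :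
    NearlyOptimalDecay g' ρ := by
  intro μ hμ
  obtain ⟨C, hC⟩ := h μ hμ
  refine ⟨C, ?_⟩
  filter_upwards [hC, hg] with x h1 h2
  rwa [← h2]

end FourierHermite

/-! ### A Phragmén–Lindelöf principle -/

/-- An entire function of order two which is bounded by `C exp (c Im z²)` on the rays at angles `η`
and `π / 2 - η` satisfies the same bound in the sector between them. -/
lemma norm_le_of_sector {F : ℂ → ℂ} (hF : Differentiable ℂ F) {C c B η : ℝ} (hη : 0 < η)
    (hη' : η < Real.pi / 4) (hB : ∀ z, ‖F z‖ ≤ C * Real.exp (B * ‖z‖ ^ 2))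
    (h1 : ∀ r : ℝ, 0 < r → ‖F (r * Complex.exp (η * Complex.I))‖ ≤
      C * Real.exp (c * Real.sin (2 * η) * r ^ 2))
    (h2 : ∀ r : ℝ, 0 < r → ‖F (r * Complex.exp ((Real.pi / 2 - η : ℝ) * Complex.I))‖ ≤
      C * Real.exp (c * Real.sin (2 * η) * r ^ 2))
    {r θ : ℝ} (hr : 0 < r) (hθ : η ≤ θ) (hθ' : θ ≤ Real.pi / 2 - η) :
    ‖F (r * Complex.exp (θ * Complex.I))‖ ≤ C * Real.exp (c * Real.sin (2 * θ) * r ^ 2) := by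
  have hC : 0 ≤ C := nonneg_of_mul_nonneg_left ((norm_nonneg _).trans (hB 0)) (Real.exp_pos _)
  -- The exponential maps a horizontal strip onto the sector, and `|exp(i c z²)| = exp(-c Im z²)`
  -- divides out the desired bound exactly, leaving the constant bound `C` to prove.
  set G : ℂ → ℂ := fun w => F (Complex.exp w) * Complex.exp (Complex.I * c * Complex.exp w ^ 2)
    with hG
  have hpolar (w : ℂ) : Complex.exp w = (Real.exp w.re : ℝ) * Complex.exp (w.im * Complex.I) := by
    rw [Complex.ofReal_exp, ← Complex.exp_add, Complex.re_add_im]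
  have hexp (w : ℂ) : ‖Complex.exp (Complex.I * c * Complex.exp w ^ 2)‖ =
      Real.exp (-(c * Real.sin (2 * w.im) * Real.exp w.re ^ 2)) := by
    rw [Complex.norm_exp]
    congr 1
    have : Complex.exp w ^ 2 = ((Real.exp w.re ^ 2 : ℝ) : ℂ) *
        Complex.exp ((2 * w.im : ℝ) * Complex.I) := by
      rw [hpolar w, mul_pow, ← Complex.exp_nat_mul]
      push_cast
      ring_nf
    have e : Complex.I * c * Complex.exp w ^ 2 =
        ((-(c * Real.sin (2 * w.im) * Real.exp w.re ^ 2) : ℝ) : ℂ) +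
          ((c * Real.cos (2 * w.im) * Real.exp w.re ^ 2 : ℝ) : ℂ) * Complex.I := by
      rw [this, Complex.exp_mul_I, ← Complex.ofReal_cos, ← Complex.ofReal_sin]
      push_cast
      linear_combination (c * Complex.exp w.re ^ 2 * Complex.sin (2 * w.im)) * Complex.I_sq
    rw [e, Complex.add_re, Complex.re_ofReal_mul, Complex.I_re, Complex.ofReal_re]
    ring
  have hGd : Differentiable ℂ G := by
    have := hF.comp Complex.differentiable_exp
    fun_prop
  have hnorm (w : ℂ) : ‖G w‖ = ‖F ((Real.exp w.re : ℝ) * Complex.exp (w.im * Complex.I))‖ *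
      Real.exp (-(c * Real.sin (2 * w.im) * Real.exp w.re ^ 2)) := by
    rw [hG, norm_mul, hexp, ← hpolar]
  have key : ∀ w : ℂ, η ≤ w.im → w.im ≤ Real.pi / 2 - η → ‖G w‖ ≤ C := by
    intro w hw hw'
    -- Growth `exp(B e^(2|Re w|))` is admissible because the strip has width `π/2 - 2η`, strictly
    -- less than `π/2`; this is where `η > 0` is needed.
    refine PhragmenLindelof.horizontal_strip (a := η) (b := Real.pi / 2 - η) hGd.diffContOnCl
      ⟨2, ?_, |B| + |c|, ?_⟩ ?_ ?_ hw hw'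
    · rw [lt_div_iff₀ (by linarith)]; linarith
    · refine Asymptotics.IsBigO.of_bound C (Eventually.of_forall fun z => ?_)
      rw [hnorm, Real.norm_of_nonneg (Real.exp_nonneg _)]
      have hle : Real.exp z.re ^ 2 ≤ Real.exp (2 * |z.re|) := by
        rw [← Real.exp_nat_mul]
        apply Real.exp_le_exp.2
        push_cast
        linarith [le_abs_self z.re]
      calc _ ≤ C * Real.exp (B * Real.exp z.re ^ 2) *
            Real.exp (-(c * Real.sin (2 * z.im) * Real.exp z.re ^ 2)) := by
            gcongr
            refine (hB _).trans_eq ?_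
            simp [Complex.norm_exp]
        _ = C * Real.exp ((B - c * Real.sin (2 * z.im)) * Real.exp z.re ^ 2) := by
            rw [mul_assoc, ← Real.exp_add]; ring_nf
        _ ≤ C * Real.exp ((|B| + |c|) * Real.exp (2 * |z.re|)) := by
            gcongr
            have h3 : |c * Real.sin (2 * z.im)| ≤ |c| := by
              rw [abs_mul]
              exact mul_le_of_le_one_right (abs_nonneg _) (Real.abs_sin_le_one _)
            linarith [le_abs_self B, neg_abs_le (c * Real.sin (2 * z.im))]
    · intro z hz
      rw [hnorm, hz]
      refine (mul_le_mul_of_nonneg_right (h1 _ (Real.exp_pos _)) (Real.exp_nonneg _)).trans_eq ?_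
      rw [mul_assoc, ← Real.exp_add]; simp
    · intro z hz
      have hs : Real.sin (2 * (Real.pi / 2 - η)) = Real.sin (2 * η) := by
        rw [mul_sub, mul_div_cancel₀ _ two_ne_zero, Real.sin_pi_sub]
      rw [hnorm, hz, hs]
      refine (mul_le_mul_of_nonneg_right (h2 _ (Real.exp_pos _)) (Real.exp_nonneg _)).trans_eq ?_
      rw [mul_assoc, ← Real.exp_add]; simp
  have h3 := key (Real.log r + θ * Complex.I) (by simpa using hθ) (by simpa using hθ')
  rw [hnorm] at h3
  simp only [Complex.add_re, Complex.ofReal_re, Complex.mul_re, Complex.I_re, mul_zero,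
    Complex.ofReal_im, Complex.I_im, mul_one, sub_self, add_zero, Complex.add_im, Complex.mul_im,
    zero_add, Real.exp_log hr] at h3
  rwa [Real.exp_neg, ← div_eq_mul_inv, div_le_iff₀ (Real.exp_pos _)] at h3

/-- The growth conditions satisfied by Bargmann transforms of functions with nearly optimal
Gaussian decay whose Fourier transforms have nearly optimal Gaussian decay as well. -/
def AxialGrowth (C lam : ℝ) (F : ℂ → ℂ) : Prop :=
  ∀ z : ℂ, ‖F z‖ ≤ C * Real.exp (z.im ^ 2 / 2 + lam * z.re ^ 2) ∧
    ‖F z‖ ≤ C * Real.exp (z.re ^ 2 / 2 + lam * z.im ^ 2)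

/-- The quarter turn exchanges the two bounds, so the first quadrant is the only one to be treated.
-/
lemma AxialGrowth.rotate {C lam : ℝ} {F : ℂ → ℂ} (h : AxialGrowth C lam F) :
    AxialGrowth C lam (fun z => F (Complex.I * z)) := fun z => by
  have := h (Complex.I * z)
  simpa using this.symm

lemma AxialGrowth.nonneg {C lam : ℝ} {F : ℂ → ℂ} (h : AxialGrowth C lam F) : 0 ≤ C :=
  nonneg_of_mul_nonneg_left ((norm_nonneg _).trans (h 0).1) (Real.exp_pos _)

/-- Within angle `η` of an axis the bound belonging to that axis already suffices: each of its two
terms is at most `sin² η · r²/2`. -/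
lemma AxialGrowth.norm_le_of_sin_sq {C η : ℝ} {F : ℂ → ℂ}
    (h : AxialGrowth C (Real.sin η ^ 2 / 2) F) {r θ : ℝ}
    (hθ : Real.sin θ ^ 2 ≤ Real.sin η ^ 2 ∨ Real.cos θ ^ 2 ≤ Real.sin η ^ 2) :
    ‖F (r * Complex.exp (θ * Complex.I))‖ ≤ C * Real.exp (Real.sin η ^ 2 * r ^ 2) := by
  have hC := h.nonneg
  have hre : (r * Complex.exp (θ * Complex.I)).re = r * Real.cos θ := by
    rw [Complex.re_ofReal_mul, Complex.exp_ofReal_mul_I_re]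
  have him : (r * Complex.exp (θ * Complex.I)).im = r * Real.sin θ := by
    rw [Complex.im_ofReal_mul, Complex.exp_ofReal_mul_I_im]
  have h1 := h (r * Complex.exp (θ * Complex.I))
  rw [hre, him, mul_pow, mul_pow] at h1
  have hr : 0 ≤ r ^ 2 := sq_nonneg r
  have hs : 0 ≤ r ^ 2 * Real.sin η ^ 2 := by positivity
  rcases hθ with hθ | hθ
  · refine h1.1.trans ?_
    gcongr
    have h2 := mul_le_mul_of_nonneg_left hθ hr
    have h3 := mul_le_mul_of_nonneg_left (Real.cos_sq_le_one θ) hs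
    nlinarith
  · refine h1.2.trans ?_
    gcongr
    have h2 := mul_le_mul_of_nonneg_left hθ hr
    have h3 := mul_le_mul_of_nonneg_left (Real.sin_sq_le_one θ) hs
    nlinarith

lemma AxialGrowth.norm_le_of_quadrant {C η : ℝ} {F : ℂ → ℂ} (hF : Differentiable ℂ F) (hη : 0 < η)
    (hη' : η < Real.pi / 4) (h : AxialGrowth C (Real.sin η ^ 2 / 2) F) {z : ℂ} (hre : 0 ≤ z.re)
    (him : 0 ≤ z.im) : ‖F z‖ ≤ C * Real.exp (Real.tan η * ‖z‖ ^ 2) := by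
  have hC := h.nonneg
  rcases eq_or_ne z 0 with rfl | hz
  · simpa using (h 0).1
  have hpi := Real.pi_pos
  have hsin : 0 < Real.sin η := Real.sin_pos_of_pos_of_lt_pi hη (by linarith)
  have hcos : 0 < Real.cos η := Real.cos_pos_of_mem_Ioo ⟨by linarith, by linarith⟩
  have htan : Real.sin η ^ 2 ≤ Real.tan η := by
    rw [Real.tan_eq_sin_div_cos, le_div_iff₀ hcos]
    nlinarith [Real.sin_le_one η, Real.cos_le_one η, mul_pos hsin hcos]
  have htan0 : 0 ≤ Real.tan η := (sq_nonneg _).trans htan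
  have hr : 0 < ‖z‖ := norm_pos_iff.2 hz
  have harg0 : 0 ≤ z.arg := Complex.arg_nonneg_iff.2 him
  have harg1 : z.arg ≤ Real.pi / 2 :=
    (le_abs_self _).trans (Complex.abs_arg_le_pi_div_two_iff.2 hre)
  rw [← Complex.norm_mul_exp_arg_mul_I z]
  have hcoe : ‖(‖z‖ : ℂ) * Complex.exp (z.arg * Complex.I)‖ = ‖z‖ := by
    rw [Complex.norm_mul_exp_arg_mul_I]
  rw [hcoe]
  by_cases hA : Real.sin z.arg ^ 2 ≤ Real.sin η ^ 2 ∨ Real.cos z.arg ^ 2 ≤ Real.sin η ^ 2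
  · refine (h.norm_le_of_sin_sq hA).trans ?_
    gcongr
  push Not at hA
  -- With `c = tan η` the sector bound equals `2 sin² η · r²` on the two boundary rays, which
  -- dominates the estimate near the axes.
  have hc2 : Real.tan η * Real.sin (2 * η) = 2 * Real.sin η ^ 2 := by
    rw [Real.sin_two_mul, Real.tan_eq_sin_div_cos]; field_simp
  have hbd (r : ℝ) : C * Real.exp (Real.sin η ^ 2 * r ^ 2) ≤
      C * Real.exp (Real.tan η * Real.sin (2 * η) * r ^ 2) := by
    rw [hc2]
    gcongr
    nlinarith [sq_nonneg (Real.sin η)]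
  refine (norm_le_of_sector hF (B := 1) (c := Real.tan η) hη hη' (fun w => ?_)
    (fun r _ => (h.norm_le_of_sin_sq (Or.inl le_rfl)).trans (hbd r))
    (fun r _ => (h.norm_le_of_sin_sq (Or.inr ?_)).trans (hbd r)) hr ?_ ?_).trans ?_
  · refine (h w).1.trans ?_
    gcongr
    rw [Complex.sq_norm, Complex.normSq_apply]
    nlinarith [Real.sin_sq_le_one η, sq_nonneg w.re, sq_nonneg w.im]
  · rw [Real.cos_pi_div_two_sub]
  · by_contra! hlt
    have := Real.sin_le_sin_of_le_of_le_pi_div_two (by linarith) (by linarith) hlt.le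
    have h0 := Real.sin_nonneg_of_nonneg_of_le_pi harg0 (by linarith)
    nlinarith [hA.1]
  · by_contra! hlt
    have := Real.cos_le_cos_of_nonneg_of_le_pi (by linarith) (by linarith) hlt.le
    rw [Real.cos_pi_div_two_sub] at this
    have h0 : 0 ≤ Real.cos z.arg := Real.cos_nonneg_of_mem_Icc ⟨by linarith, harg1⟩
    nlinarith [hA.2]
  · gcongr
    exact mul_le_of_le_one_right htan0 (Real.sin_le_one _)

lemma AxialGrowth.norm_le_of_upper {C η : ℝ} {F : ℂ → ℂ} (hF : Differentiable ℂ F) (hη : 0 < η)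
    (hη' : η < Real.pi / 4) (h : AxialGrowth C (Real.sin η ^ 2 / 2) F) {z : ℂ} (him : 0 ≤ z.im) :
    ‖F z‖ ≤ C * Real.exp (Real.tan η * ‖z‖ ^ 2) := by
  rcases le_total 0 z.re with hre | hre
  · exact h.norm_le_of_quadrant hF hη hη' hre him
  · have := h.rotate.norm_le_of_quadrant (by fun_prop) hη hη' (z := -Complex.I * z)
      (by simpa using him) (by simpa using hre)
    simpa [← mul_assoc] using this

/-- A **Phragmén–Lindelöf principle**: an entire function of order two with type `1/2` which has
small type near both axes has small type. -/
theorem AxialGrowth.norm_le {C η : ℝ} {F : ℂ → ℂ} (hF : Differentiable ℂ F) (hη : 0 < η)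
    (hη' : η < Real.pi / 4) (h : AxialGrowth C (Real.sin η ^ 2 / 2) F) (z : ℂ) :
    ‖F z‖ ≤ C * Real.exp (Real.tan η * ‖z‖ ^ 2) := by
  rcases le_total 0 z.im with him | him
  · exact h.norm_le_of_upper hF hη hη' him
  · have := h.rotate.rotate.norm_le_of_upper (by fun_prop) hη hη' (z := -z) (by simpa using him)
    simpa [← mul_assoc] using this

/-! ### From coordinatewise decay to Hermite coefficients -/

section Decay

variable {d : ℕ}

/-- The decay in the coordinate `x_k` of largest modulus is shared out: with `δ = λ/(2d)`, `(1/2-λ)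
x_j² + δ ∑_(i≠j) x_i² ≤ (1/2-λ/2) x_k²`. The result is nearly optimal in `x_j` and still Gaussian in
the other variables. -/
lemma exists_prod_decay {g : EuclideanSpace ℝ (Fin d) → ℂ}
    (h : ∀ i : Fin d, NearlyOptimalDecay g (fun x => |x i|)) (j : Fin d) {lam : ℝ}
    (hlam : 0 < lam) (hlam' : lam ≤ 1 / 4) :
    ∃ δ C : ℝ, 0 < δ ∧ 0 ≤ C ∧ ∀ᵐ x, ‖g x‖ ≤
      C * ∏ i, Real.exp (-(if i = j then 1 / 2 - lam else δ) * x i ^ 2) := by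
  choose C hC using fun i => h i (lam / 2) (by positivity)
  have hd : (0 : ℝ) < d := by exact_mod_cast j.pos
  refine ⟨lam / (2 * d), ∑ i, |C i|, by positivity, by positivity, ?_⟩
  filter_upwards [ae_all_iff.2 hC] with x hx
  obtain ⟨k, -, hk⟩ := Finset.exists_max_image Finset.univ (fun i => x i ^ 2) ⟨j, Finset.mem_univ j⟩
  rw [← Real.exp_sum]
  have hsum : ∑ i, -(if i = j then 1 / 2 - lam else lam / (2 * d)) * x i ^ 2 ≥
      -(1 / 2 - lam / 2) * x k ^ 2 := by
    rw [← Finset.add_sum_erase _ _ (Finset.mem_univ j), if_pos rfl]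
    have h1 : ∑ i ∈ Finset.univ.erase j, -(if i = j then 1 / 2 - lam else lam / (2 * d)) * x i ^ 2 ≥
        ∑ i ∈ Finset.univ.erase j, -(lam / (2 * d)) * x k ^ 2 := by
      refine Finset.sum_le_sum fun i hi => ?_
      rw [if_neg (Finset.ne_of_mem_erase hi), neg_mul, neg_mul]
      exact neg_le_neg (mul_le_mul_of_nonneg_left (hk i (Finset.mem_univ i)) (by positivity))
    have h2 : ∑ i ∈ Finset.univ.erase j, -(lam / (2 * d)) * x k ^ 2 ≥
        ∑ _i : Fin d, -(lam / (2 * d)) * x k ^ 2 := by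
      rw [← Finset.add_sum_erase _ _ (Finset.mem_univ j)]
      have : 0 ≤ lam / (2 * d) * x k ^ 2 := by positivity
      linarith
    have h3 : ∑ _i : Fin d, -(lam / (2 * d)) * x k ^ 2 = -(lam / 2) * x k ^ 2 := by
      simp; field_simp
    have h4 := mul_le_mul_of_nonneg_left (hk j (Finset.mem_univ j))
      (by linarith : (0 : ℝ) ≤ 1 / 2 - lam)
    linarith
  have hxk := hx k
  rw [sq_abs] at hxk
  refine hxk.trans ?_
  have hCk : C k ≤ ∑ i, |C i| := (le_abs_self _).trans
    (Finset.single_le_sum (f := fun i => |C i|) (fun _ _ => abs_nonneg _) (Finset.mem_univ k))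
  gcongr

lemma integrable_exp_mul_hermiteFn {δ : ℝ} (hδ : 0 < δ) (n : ℕ) :
    Integrable (fun t : ℝ => Real.exp (-δ * t ^ 2) * ‖(hermiteFn n t : ℂ)‖) :=
  (memLp_two_exp_neg_mul_sq hδ).integrable_mul (memLp_hermiteFn n).norm

lemma integral_exp_mul_hermiteFn_le {δ : ℝ} (hδ : 0 < δ) (n : ℕ) :
    ∫ t : ℝ, Real.exp (-δ * t ^ 2) * ‖(hermiteFn n t : ℂ)‖ ≤
      ((∫ t : ℝ, Real.exp (-δ * t ^ 2) ^ 2) + 1) / 2 := by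
  have h1 := (memLp_two_iff_integrable_sq (by fun_prop)).1 (memLp_two_exp_neg_mul_sq hδ)
  have h2 := (memLp_two_iff_integrable_sq_norm (memLp_hermiteFn n).1).1 (memLp_hermiteFn n)
  rw [← integral_norm_sq_hermiteFn n, ← integral_add h1 h2, ← integral_div]
  refine integral_mono (integrable_exp_mul_hermiteFn hδ n) ((h1.add h2).div_const 2) fun t => ?_
  dsimp only
  nlinarith [sq_nonneg (Real.exp (-δ * t ^ 2) - ‖(hermiteFn n t : ℂ)‖)]

lemma exp_mul_norm_bargmannKernel_le {lam : ℝ} (hlam : 0 < lam) (hlam' : lam ≤ 1 / 4) (z : ℂ)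
    (t : ℝ) : Real.exp (-(1 / 2 - lam) * t ^ 2) * ‖bargmannKernel z t‖ ≤
      Real.exp (z.im ^ 2 / 2 + 2 * lam * z.re ^ 2) * Real.exp (-lam * t ^ 2) := by
  refine (mul_le_mul_of_nonneg_left (norm_bargmannKernel_le z t (a := 1 - 2 * lam) (by linarith))
    (Real.exp_pos _).le).trans ?_
  rw [← Real.exp_add, ← Real.exp_add, ← Real.exp_add]
  apply Real.exp_le_exp.2
  -- Equivalent to `(1-2λ)(1+4λ) ≥ 1` when `Re z ≠ 0`; this is where `λ ≤ 1/4` enters.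
  have h1 : z.re ^ 2 / (2 * (1 - 2 * lam)) ≤ z.re ^ 2 * (1 / 2 + 2 * lam) := by
    rw [div_le_iff₀ (by linarith), mul_assoc]
    apply le_mul_of_one_le_right (sq_nonneg _)
    nlinarith
  nlinarith

/-- The partial Bargmann transform (in the `j`-th variable) of a Hermite coefficient. -/
noncomputable def partialBargmann (f : L2 d) (j : Fin d) (α : Fin d → ℕ) (z : ℂ) : ℂ :=
  tensorPairing f
    (Function.update (fun i t => (hermiteFn (α i) t : ℂ)) j (bargmannKernel z))

lemma hasSum_partialBargmann (f : L2 d) (j : Fin d) (α : Fin d → ℕ) (z : ℂ) :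
    HasSum (fun n : ℕ => z ^ n * (((√n.factorial : ℝ) : ℂ)⁻¹ *
      hermiteCoeff f (Function.update α j n))) (partialBargmann f j α z) := by
  convert! hasSum_tensorPairing f (u := fun i t => (hermiteFn (α i) t : ℂ))
    (fun i => memLp_hermiteFn (α i)) j z using 4 with n
  rw [hermiteCoeff_eq_tensorPairing]
  congr 1
  ext i t
  rcases eq_or_ne i j with rfl | hi
  · simp
  · simp [hi]

/-- In the power series `i^n` cancels the factor `(-i)^n` from the `j`-th index, and the remaining
indices contribute a unimodular constant. -/
lemma norm_partialBargmann_fourierHatLp (f : L2 d) (j : Fin d) (α : Fin d → ℕ) (z : ℂ) :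
    ‖partialBargmann (fourierHatLp f) j α (Complex.I * z)‖ = ‖partialBargmann f j α z‖ := by
  have h1 := hasSum_partialBargmann (fourierHatLp f) j α (Complex.I * z)
  have h2 := (hasSum_partialBargmann f j α z).mul_left
    ((-Complex.I) ^ ∑ i ∈ Finset.univ.erase j, α i)
  have h3 : partialBargmann (fourierHatLp f) j α (Complex.I * z) =
      (-Complex.I) ^ (∑ i ∈ Finset.univ.erase j, α i) * partialBargmann f j α z := by
    refine h1.unique ?_
    convert! h2 using 2 with n
    have hlen : multiLength (Function.update α j n) = n + ∑ i ∈ Finset.univ.erase j, α i := by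
      rw [multiLength, ← Finset.add_sum_erase _ _ (Finset.mem_univ j), Function.update_self]
      congr 1
      exact Finset.sum_congr rfl fun i hi => Function.update_of_ne (Finset.ne_of_mem_erase hi) _ _
    have hI : Complex.I ^ n * (-Complex.I) ^ n = 1 := by rw [← mul_pow]; simp
    rw [hermiteCoeff_fourierHatLp, hlen, pow_add, mul_pow]
    linear_combination (z ^ n * (((√n.factorial : ℝ) : ℂ)⁻¹ *
      hermiteCoeff f (Function.update α j n)) *
      (-Complex.I) ^ ∑ i ∈ Finset.univ.erase j, α i) * hI
  rw [h3]
  simp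

/-- The constant must not depend on `α`. Each variable other than `x_j` contributes `∫
e^(-δt²)|h_n|`, which is bounded independently of `n` by normalization. -/
lemma exists_partialBargmann_bound (f : L2 d)
    (h : ∀ i : Fin d, NearlyOptimalDecay f (fun x => |x i|)) (j : Fin d) {lam : ℝ}
    (hlam : 0 < lam) (hlam' : lam ≤ 1 / 4) :
    ∃ C : ℝ, ∀ (α : Fin d → ℕ) (z : ℂ), ‖partialBargmann f j α z‖ ≤
      C * Real.exp (z.im ^ 2 / 2 + 2 * lam * z.re ^ 2) := by
  obtain ⟨δ, C, hδ, hC, hf⟩ := exists_prod_decay h j hlam hlam'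
  set D : ℝ := ((∫ t : ℝ, Real.exp (-δ * t ^ 2) ^ 2) + 1) / 2 with hD
  have hD0 : 0 ≤ D := by
    have : 0 ≤ ∫ t : ℝ, Real.exp (-δ * t ^ 2) ^ 2 := integral_nonneg fun _ => sq_nonneg _
    positivity
  set J : ℝ := ∫ t : ℝ, Real.exp (-lam * t ^ 2) with hJ
  refine ⟨C * (J * ∏ _i ∈ Finset.univ.erase j, D), fun α z => ?_⟩
  set v : Fin d → ℝ → ℂ :=
    Function.update (fun i t => (hermiteFn (α i) t : ℂ)) j (bargmannKernel z) with hv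
  have hvmem (i : Fin d) : MemLp (v i) 2 :=
    memLp_update (fun i => memLp_hermiteFn (α i)) j (memLp_bargmannKernel z) i
  set b : Fin d → ℝ := fun i => if i = j then 1 / 2 - lam else δ with hb
  have hb0 (i : Fin d) : 0 < b i := by
    simp only [hb]; split_ifs
    · linarith
    · exact hδ
  set V : Fin d → ℝ → ℝ := fun i t => Real.exp (-b i * t ^ 2) * ‖v i t‖ with hV
  have hVint (i : Fin d) : Integrable (V i) :=
    (memLp_two_exp_neg_mul_sq (hb0 i)).integrable_mul (hvmem i).norm
  have hV0 (i : Fin d) : 0 ≤ ∫ t, V i t := integral_nonneg fun t => by positivity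
  have hVj : ∫ t, V j t ≤ Real.exp (z.im ^ 2 / 2 + 2 * lam * z.re ^ 2) * J := by
    rw [hJ, ← integral_const_mul]
    refine integral_mono (hVint j) ((integrable_exp_neg_mul_sq hlam).const_mul _) fun t => ?_
    simp only [hV, hv, hb, if_true, Function.update_self]
    exact exp_mul_norm_bargmannKernel_le hlam hlam' z t
  have hVi (i : Fin d) (hi : i ≠ j) : ∫ t, V i t ≤ D := by
    simpa [hV, hv, hb, hi, hD] using integral_exp_mul_hermiteFn_le hδ (α i)
  calc ‖partialBargmann f j α z‖ ≤ ∫ x : EuclideanSpace ℝ (Fin d), C * ∏ i, V i (x i) := by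
        refine norm_integral_le_of_norm_le ((integrable_tensor hVint).const_mul C) ?_
        filter_upwards [hf] with x hx
        rw [norm_mul, norm_prod, Finset.prod_mul_distrib, ← mul_assoc]
        gcongr
    _ = C * ((∫ t, V j t) * ∏ i ∈ Finset.univ.erase j, ∫ t, V i t) := by
        rw [integral_const_mul, integral_tensor,
          ← Finset.mul_prod_erase _ _ (Finset.mem_univ j)]
    _ ≤ C * ((Real.exp (z.im ^ 2 / 2 + 2 * lam * z.re ^ 2) * J) *
          ∏ _i ∈ Finset.univ.erase j, D) := by
        have hprod : ∏ i ∈ Finset.univ.erase j, ∫ t, V i t ≤ ∏ _i ∈ Finset.univ.erase j, D :=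
          Finset.prod_le_prod (fun i _ => hV0 i) fun i hi => hVi i (Finset.ne_of_mem_erase hi)
        have h0 : 0 ≤ ∏ i ∈ Finset.univ.erase j, ∫ t, V i t :=
          Finset.prod_nonneg fun i _ => hV0 i
        exact mul_le_mul_of_nonneg_left (mul_le_mul hVj hprod h0 ((hV0 j).trans hVj)) hC
    _ = _ := by ring

lemma exists_hermiteCoeff_bound (f : L2 d)
    (h : ∀ i : Fin d, NearlyOptimalDecay f (fun x => |x i|) ∧
      NearlyOptimalDecay (fourierHat f) (fun x => |x i|)) (j : Fin d) {r : ℝ} (hr : 0 < r) :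
    ∃ C : ℝ, 0 ≤ C ∧ ∀ α : Fin d → ℕ, ‖hermiteCoeff f α‖ ≤ C * Real.exp (-r * α j) := by
  -- The type of the entire function will be `tan η = q²`. On the circle of radius `√(n+1)/q` its
  -- bound is `C e^(n+1)`, while Cauchy's estimate gains `q^n = e^(-(1+r)n)`; the net rate is
  -- `e^(-rn)`.
  set q : ℝ := Real.exp (-(1 + r)) with hq
  have hq0 : 0 < q := Real.exp_pos _
  have hq1 : q ^ 2 < 1 := by
    rw [hq, ← Real.exp_nat_mul, Real.exp_lt_one_iff]; push_cast; linarith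
  set η : ℝ := Real.arctan (q ^ 2) with hη
  have hη0 : 0 < η := Real.arctan_pos.2 (by positivity)
  have hη1 : η < Real.pi / 4 := by
    rw [← Real.arctan_one]; exact Real.arctan_strictMono hq1
  have hpi := Real.pi_pos
  have hsin : 0 < Real.sin η := Real.sin_pos_of_pos_of_lt_pi hη0 (by linarith)
  obtain ⟨C₁, hC₁⟩ := exists_partialBargmann_bound f (fun i => (h i).1) j
    (lam := Real.sin η ^ 2 / 4) (by positivity) (by linarith [Real.sin_sq_le_one η])
  obtain ⟨C₂, hC₂⟩ := exists_partialBargmann_bound (fourierHatLp f)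
    (fun i => (h i).2.congr (coeFn_fourierHatLp f).symm) j
    (lam := Real.sin η ^ 2 / 4) (by positivity) (by linarith [Real.sin_sq_le_one η])
  set C : ℝ := max C₁ C₂ with hC
  have hlam : 2 * (Real.sin η ^ 2 / 4) = Real.sin η ^ 2 / 2 := by ring
  rw [hlam] at hC₁ hC₂
  have hG (α : Fin d → ℕ) : AxialGrowth C (Real.sin η ^ 2 / 2) (partialBargmann f j α) := by
    intro z
    constructor
    · refine (hC₁ α z).trans ?_
      gcongr
      exact le_max_left _ _
    · rw [← norm_partialBargmann_fourierHatLp]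
      refine (hC₂ α _).trans ?_
      have e1 : (Complex.I * z).im ^ 2 = z.re ^ 2 := by simp
      have e2 : (Complex.I * z).re ^ 2 = z.im ^ 2 := by simp
      rw [e1, e2]
      gcongr
      exact le_max_right _ _
  have hC0 : 0 ≤ C := (hG 0).nonneg
  refine ⟨C * Real.exp 1, by positivity, fun α => ?_⟩
  set n := α j with hn
  have hR : 0 < √(n + 1 : ℝ) / q := by positivity
  have hR2 : √(n + 1 : ℝ) ^ 2 = n + 1 := Real.sq_sqrt (by positivity)
  have hbound (z : ℂ) (hz : ‖z‖ = √(n + 1 : ℝ) / q) :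
      ‖partialBargmann f j α z‖ ≤ C * Real.exp (n + 1) := by
    refine ((hG α).norm_le (differentiable_of_hasSum_pow (hasSum_partialBargmann f j α))
      hη0 hη1 z).trans_eq ?_
    rw [hz, hη, Real.tan_arctan, div_pow, hR2]
    congr 2
    field_simp
  have hcoef := norm_le_of_hasSum_pow (hasSum_partialBargmann f j α) hR hbound n
  rw [hn, Function.update_eq_self, ← hn, norm_mul, norm_inv, Complex.norm_real,
    Real.norm_of_nonneg (Real.sqrt_nonneg _), inv_mul_le_iff₀ (by positivity)] at hcoef
  refine hcoef.trans ?_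
  have h1 : √(n.factorial : ℝ) ≤ √(n + 1) ^ n := sqrt_factorial_le n
  have h2 : q ^ n * Real.exp (n + 1) = Real.exp 1 * Real.exp (-r * n) := by
    rw [hq, ← Real.exp_nat_mul, ← Real.exp_add, ← Real.exp_add]; ring_nf
  calc √(n.factorial : ℝ) * (C * Real.exp (n + 1) / (√(n + 1 : ℝ) / q) ^ n)
      ≤ √(n + 1) ^ n * (C * Real.exp (n + 1) / (√(n + 1 : ℝ) / q) ^ n) := by gcongr
    _ = C * (q ^ n * Real.exp (n + 1)) := by rw [div_pow]; field_simp
    _ = _ := by rw [h2]; ring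

theorem superexpDecay_of_nearlyOptimalDecay (f : L2 d)
    (h : ∀ i : Fin d, NearlyOptimalDecay f (fun x => |x i|) ∧
      NearlyOptimalDecay (fourierHat f) (fun x => |x i|)) :
    SuperexpDecay (hermiteCoeff f) := by
  intro r hr
  -- For `d = 0` there is no coordinate to use, but the only multi-index has length `0` and any
  -- bound on its coefficient will do.
  rcases Nat.eq_zero_or_pos d with rfl | hd
  · exact ⟨‖f‖, fun α => by simpa [multiLength] using norm_hermiteCoeff_le f α⟩
  have hd' : (0 : ℝ) < d := by exact_mod_cast hd
  -- The largest entry satisfies `d α_k ≥ |α|`, so rate `r d` in each coordinate gives rate `r` in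
  -- `|α|`.
  choose C hC0 hC using fun j => exists_hermiteCoeff_bound f h j (r := r * d) (by positivity)
  refine ⟨∑ j, C j, fun α => ?_⟩
  obtain ⟨k, -, hk⟩ := Finset.exists_max_image Finset.univ α ⟨⟨0, hd⟩, Finset.mem_univ _⟩
  have hlen : (multiLength α : ℝ) ≤ d * α k := by
    have : multiLength α ≤ d * α k := by
      simpa [multiLength] using Finset.sum_le_card_nsmul Finset.univ α (α k) hk
    exact_mod_cast this
  refine (hC k α).trans ?_
  have hCk : C k ≤ ∑ j, C j := Finset.single_le_sum (fun j _ => hC0 j) (Finset.mem_univ k)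
  have hsum : 0 ≤ ∑ j, C j := Finset.sum_nonneg fun j _ => hC0 j
  refine mul_le_mul hCk (Real.exp_le_exp.2 ?_) (Real.exp_pos _).le hsum
  have := mul_le_mul_of_nonneg_left hlen hr.le
  linarith

lemma NearlyOptimalDecay.mono {g : EuclideanSpace ℝ (Fin d) → ℂ}
    {ρ σ : EuclideanSpace ℝ (Fin d) → ℝ} (h : NearlyOptimalDecay g σ) (h0 : ∀ x, 0 ≤ ρ x)
    (hle : ∀ x, ρ x ≤ σ x) : NearlyOptimalDecay g ρ := by
  intro μ hμ
  -- Capping at `1/2` keeps the coefficient `1/2 - μ` nonnegative, without which `ρ ≤ σ` would work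
  -- in the wrong direction.
  obtain ⟨C, hC⟩ := h (min μ (1 / 2)) (by positivity)
  refine ⟨|C|, ?_⟩
  filter_upwards [hC] with x hx
  refine hx.trans (mul_le_mul (le_abs_self C) ?_ (Real.exp_pos _).le (abs_nonneg _))
  apply Real.exp_le_exp.2
  have h1 : ρ x ^ 2 ≤ σ x ^ 2 := pow_le_pow_left₀ (h0 x) (hle x) 2
  have h2 := mul_le_mul_of_nonneg_left h1 (sub_nonneg.2 (min_le_right μ (1 / 2)))
  have h3 := mul_le_mul_of_nonneg_right (min_le_left μ (1 / 2)) (sq_nonneg (ρ x))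
  nlinarith

end Decay

theorem theorem1p2 (d : ℕ) (f : L2 d) :
    List.TFAE
      [ -- (i) coordinate-wise decay
        ∀ j : Fin d, NearlyOptimalDecay f (fun x => |x j|) ∧
          NearlyOptimalDecay (fourierHat f) (fun ξ => |ξ j|),
        -- (ii) decay in the full norm
        NearlyOptimalDecay f (fun x => ‖x‖) ∧ NearlyOptimalDecay (fourierHat f) (fun ξ => ‖ξ‖),
        -- (iii) decay of the Hermite coefficients
        SuperexpDecay (hermiteCoeff f),
        -- membership in the Pilipović space
        f ∈ pilipovicSpace d ] := by
  tfae_have 2 → 1 := fun h j => by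
    have hle (x : EuclideanSpace ℝ (Fin d)) : |x j| ≤ ‖x‖ := by
      simpa using PiLp.norm_apply_le x j
    exact ⟨h.1.mono (fun _ => abs_nonneg _) hle, h.2.mono (fun _ => abs_nonneg _) hle⟩
  tfae_have 1 → 3 := superexpDecay_of_nearlyOptimalDecay f
  tfae_have 3 → 2 := fun h => ⟨nearlyOptimalDecay_of_superexpDecay f h,
    (nearlyOptimalDecay_of_superexpDecay _ (superexpDecay_fourierHatLp f h)).congr
      (coeFn_fourierHatLp f)⟩
  tfae_have 4 ↔ 3 := mem_pilipovicSpace_iff f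
  tfae_finish
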